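/- **Setting.** Let $L,T>0$, $\mathbb T^3_L=\mathbb R^3/L\mathbb Z^3$, $\Omega_T=[0,T]\times\mathbb T^3_L$, $\langle g\rangle=\frac1{TL^3}\int_{\Omega_T}g\,dx\,dt$, $\lambda_q=2^q/L$ and $\ell_q=\lambda_q^{-1}$. *Littlewood–Paley blocks.* Let $\chi\in C_0^\infty(B(0,1))$ be a nonnegative radial function on $\mathbb R^3$ with $\chi(\xi)=1$ for $|\xi|\le\frac12$, and put $\phi(\xi)=\chi(\xi/2)-\chi(\xi)$, $\varphi_{-1}(\xi)=\chi(L\xi)$, $\varphi_q(\xi)=\phi(L\xi/2^q)$ for $q\ge0$. For a field $u$ let $u_q(t,x)=\sum_{k\in\frac1L\mathbb Z^3}\varphi_q(k)\,\hat u(t,k)\,e^{2\pi ik\cdot x}$, $q\ge-1$, where $\hat u(t,k)=L^{-3}\int_{\mathbb T^3_L}u(t,x)e^{-2\pi ik\cdot x}dx$. *Energy flux density.* For $q\ge 0$ let $$\pi_q=\sum_{\substack{p'\ge q-1,\ p''\ge q,\ -1\le p'''<q\\|p'-p''|<2}}(u_{p'}\otimes u_{p''}):\nabla u_{p'''},\qquad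 (a\otimes b):\nabla w=\sum_{i,j}a_ib_j\,\partial_iw_j .$$ The energy flux *concentrates* on a measurable set $G\subset\Omega_T$ if there is a decreasing sequence of relatively open sets $G_q\subset\Omega_T$ with $G=\bigcap_qG_q$ and $\lim_{p\to\infty}\langle|\pi_p|\mathbf 1_{\Omega_T\setminus G_q}\rangle=0$ for every $q$. *Active regions.* Let $Q_{qk}=\ell_qk+[0,\ell_q)^3\subset\mathbb T^3_L$, and let $Q^*_{qk}=\bigcup_{|k'-k|<3}Q_{qk'}$ ($k'\in\mathbb Z^3$, Euclidean norm). Let $\eta$ be a smooth function on $\mathbb R^3$ vanishing outside $B(0,1)$, with $\int\eta=1$; let $\eta_q(x)=2^{3q}\eta(\lambda_qx)$ and let $\chi'_{qk}$ be the convolution (with respect to $L^{-3}dx$) of the characteristic function of $Q_{qk}$ with $\eta_q$. Fix an integer $M\ge1$ and let $$s_{qk}(t)=\max_{|\beta|\le M}\lambda_q^{-|\beta|}\,\bigl\|\partial_x^\beta\bigl(u_q\chi'_{qk}\bigr)(t,\cdot)\bigr\|_{L^\infty}.$$ Let $\sigma_q>0$ be a decreasing sequence with $\sigma_q\to0$ and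 $\frac{\log\sigma_q}{q}\to0$. For $q\ge0$ let $A_q$ (resp. $A_q^\circ$) be the set of $(t,x)\in\Omega_T$ such that $x\in Q^*_{qk}$ (resp. $x$ is in the interior of $Q^*_{qk}$) for some $k\in[0,2^q-1]^3\cap\mathbb Z^3$ with $s_{qk}(t)>\sigma_q\langle|u_q|^3\rangle/\langle|u_q|^2\rangle$; both sets are empty if $u_q$ vanishes identically. **Theorem.** Let $f,u_0\in L^2(\mathbb T^3_L;\mathbb R^3)$ and let $u\in C_w([0,T];L^2(\mathbb T^3_L;\mathbb R^3))$ be a weak solution of the Euler equations with time independent force $f$ and initial data $u_0$, that is, $u(t)$ is divergence free in the sense of distributions for every $t\in[0,T]$, and for every smooth $\psi:[0,T]\times\mathbb T^3_L\to\mathbb R^3$ with $\nabla_x\cdot\psi=0$ and every $t\in[0,T]$, $$\int_{\mathbb T^3_L}u(t)\cdot\psi(t)\,dx-\int_{\mathbb T^3_L}u_0\cdot\psi(0)\,dx-\int_0^t\!\!\int_{\mathbb T^3_L}u\cdot\partial_s\psi\,dx\,ds=\int_0^t\!\!\int_{\mathbb T^3_L}(u\otimes u):\nabla\psi\,dx\,ds+\int_0^t\!\!\int_{\mathbb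 T^3_L}f\cdot\psi\,dx\,ds .$$ Suppose that $$\varepsilon=\limsup_{q\to\infty}\lambda_q\langle|u_q|^3\rangle<\infty .$$ Then, for every $p\ge0$, the series defining $\pi_p$ converges absolutely almost everywhere on $\Omega_T$ and $\pi_p\in L^1(\Omega_T)$; the energy flux concentrates on $A^\circ=\limsup_{q\to\infty}A^\circ_q$, which coincides up to a set of measure zero with $A=\limsup_{q\to\infty}A_q$; and for every $q\ge0$, $$\lim_{p\to\infty}\bigl\langle|\pi_p|\,\mathbf 1_{\Omega_T\setminus\bigcup_{r\ge q}A^\circ_r}\bigr\rangle=0 \qquad\text{and}\qquad \lim_{p\to\infty}\bigl\langle|\pi_p|\,\mathbf 1_{\Omega_T\setminus\bigcup_{r\ge q}A_r}\bigr\rangle=0 .$$ -/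

import Mathlib

open MeasureTheory Filter Topology Set
open scoped ContDiff

noncomputable section

namespace EulerFlux

/-- Three-dimensional Euclidean space. Functions on the torus of side `L` are represented by
functions on this space that are `L`-periodic in each coordinate; subsets of the torus are
represented by `L`-periodic subsets. -/
abbrev E3 : Type := EuclideanSpace ℝ (Fin 3)

/-- The `i`-th vector of the standard basis. -/
def e (i : Fin 3) : E3 := EuclideanSpace.single i (1 : ℝ)

/-- `L`-periodicity in each of the three coordinates. -/
def Periodic {F : Type} (L : ℝ) (g : E3 → F) : Prop :=
  ∀ (x : E3) (i : Fin 3), g (x + L • e i) = g x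

/-- The fundamental domain `[0, L)³` of the torus. -/
def box (L : ℝ) : Set E3 := {x | ∀ i, x i ∈ Ico (0 : ℝ) L}

/-- The fundamental domain `[0, T] × [0, L)³` of the space-time domain `Ω_T`. -/
def cylinder (L T : ℝ) : Set (ℝ × E3) := Icc (0 : ℝ) T ×ˢ box L

/-- The full periodic space-time domain `[0, T] × ℝ³`, which represents `Ω_T`. -/
def slab (T : ℝ) : Set (ℝ × E3) := Icc (0 : ℝ) T ×ˢ (univ : Set E3)

/-- The space-time average `⟨g⟩` over `Ω_T`. -/
def avg (L T : ℝ) (g : ℝ × E3 → ℝ) : ℝ :=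
  (T * L ^ 3)⁻¹ * ∫ z in cylinder L T, g z

/-! ### Weak solutions of the Euler equations -/

/-- The divergence of a vector field. -/
def divergence (g : E3 → E3) (x : E3) : ℝ := ∑ i, (fderiv ℝ g x (e i)) i

/-- `u ∈ C_w([0, T]; L²)`: a family of periodic square integrable fields which is continuous
in time for the weak topology of `L²` of the torus. -/
structure WeaklyContinuous (L T : ℝ) (u : ℝ → E3 → E3) : Prop where
  periodic : ∀ t ∈ Icc (0 : ℝ) T, Periodic L (u t)
  memLp : ∀ t ∈ Icc (0 : ℝ) T, MemLp (u t) 2 (volume.restrict (box L))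
  continuousOn : ∀ g : E3 → E3, MemLp g 2 (volume.restrict (box L)) →
    ContinuousOn (fun t => ∫ x in box L, inner ℝ (u t x) (g x)) (Icc (0 : ℝ) T)

/-- Smooth periodic vector-valued test functions on `[0, T]` times the torus which are
divergence free in space. -/
structure IsTestField (L T : ℝ) (ψ : ℝ → E3 → E3) : Prop where
  smooth : ContDiff ℝ ∞ (fun z : ℝ × E3 => ψ z.1 z.2)
  periodic : ∀ t, Periodic L (ψ t)
  div_free : ∀ t ∈ Icc (0 : ℝ) T, ∀ x, divergence (ψ t) x = 0

/-- `u` is a weak solution of the Euler equations on `[0, T]` times the torus of side `L`, with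
time independent force `f` and initial data `u₀`. Here `(u ⊗ u) : ∇ψ = ∑ uᵢ uⱼ ∂ᵢ ψⱼ`. -/
structure IsWeakEulerSolution (L T : ℝ) (f u₀ : E3 → E3) (u : ℝ → E3 → E3) : Prop where
  weaklyContinuous : WeaklyContinuous L T u
  div_free : ∀ t ∈ Icc (0 : ℝ) T, ∀ θ : E3 → ℝ, ContDiff ℝ ∞ θ → Periodic L θ →
    ∫ x in box L, fderiv ℝ θ x (u t x) = 0
  weak_form : ∀ ψ : ℝ → E3 → E3, IsTestField L T ψ → ∀ t ∈ Icc (0 : ℝ) T,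
    (∫ x in box L, inner ℝ (u t x) (ψ t x)) - (∫ x in box L, inner ℝ (u₀ x) (ψ 0 x))
        - (∫ s in (0 : ℝ)..t, ∫ x in box L, inner ℝ (u s x) (deriv (fun r => ψ r x) s))
      = (∫ s in (0 : ℝ)..t, ∫ x in box L, inner ℝ (u s x) (fderiv ℝ (ψ s) x (u s x)))
        + ∫ s in (0 : ℝ)..t, ∫ x in box L, inner ℝ (f x) (ψ s x)

/-! ### Littlewood-Paley decomposition -/

/-- The radial cut-off function from which the dyadic decomposition is built. -/
structure IsCutoff (χ : E3 → ℝ) : Prop where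
  smooth : ContDiff ℝ ∞ χ
  nonneg : ∀ ξ, 0 ≤ χ ξ
  radial : ∀ ξ ξ' : E3, ‖ξ‖ = ‖ξ'‖ → χ ξ = χ ξ'
  supp : tsupport χ ⊆ Metric.ball 0 1
  one : ∀ ξ : E3, ‖ξ‖ ≤ 1 / 2 → χ ξ = 1

/-- The dyadic symbols: `φ₋₁(ξ) = χ(Lξ)` and, for `q ≥ 0`, `φ_q(ξ) = φ(Lξ/2^q)` with
`φ(ξ) = χ(ξ/2) - χ(ξ)`. There are no blocks below `q = -1`. -/
def symbol (χ : E3 → ℝ) (L : ℝ) (q : ℤ) (ξ : E3) : ℝ :=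
  if q = -1 then χ (L • ξ)
  else if 0 ≤ q then χ ((1 / 2 : ℝ) • (L / 2 ^ q) • ξ) - χ ((L / 2 ^ q) • ξ)
  else 0

/-- The lattice point `n / L`, for `n ∈ ℤ³`. -/
def freq (L : ℝ) (n : Fin 3 → ℤ) : E3 := WithLp.toLp 2 (fun i => (n i : ℝ) / L)

/-- The character `exp(2πi k·x)`. -/
def character (k x : E3) : ℂ :=
  Complex.exp (2 * Real.pi * Complex.I * ((inner ℝ k x : ℝ) : ℂ))

/-- The Fourier coefficient at `k` of a scalar function on the torus. -/
def boxFourierCoeff (L : ℝ) (g : E3 → ℝ) (k : E3) : ℂ :=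
  ((L ^ 3)⁻¹ : ℝ) * ∫ x in box L, (g x : ℂ) * character (-k) x

/-- The Littlewood-Paley block `g_q = F⁻¹(φ_q F(g))` of a real vector field, componentwise.
The sum has finitely many non-zero terms, and it is real because the symbol is even; taking the
real part only turns it into a real number. -/
def block (χ : E3 → ℝ) (L : ℝ) (q : ℤ) (g : E3 → E3) (x : E3) : E3 :=
  WithLp.toLp 2 (fun i =>
    (∑' n : Fin 3 → ℤ, (symbol χ L q (freq L n) : ℂ) *
      boxFourierCoeff L (fun y => g y i) (freq L n) * character (freq L n) x).re)

/-- The wave number `λ_q = 2^q / L`. -/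
def waveNumber (L : ℝ) (q : ℕ) : ℝ := 2 ^ q / L

/-- The moment `⟨|u_q|^r⟩`. -/
def moment (χ : E3 → ℝ) (L T : ℝ) (u : ℝ → E3 → E3) (r : ℕ) (q : ℤ) : ℝ :=
  avg L T (fun z => ‖block χ L q (u z.1) z.2‖ ^ r)

/-! ### Energy flux density -/

/-- The triples `(p', p'', p''')` of block indices that enter the flux through scale `q`. -/
def fluxIndex (q : ℕ) : Set (ℤ × ℤ × ℤ) :=
  {P | (q : ℤ) - 1 ≤ P.1 ∧ (q : ℤ) ≤ P.2.1 ∧ -1 ≤ P.2.2 ∧ P.2.2 < (q : ℤ) ∧ |P.1 - P.2.1| < 2}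

/-- The interaction `(u_{p'} ⊗ u_{p''}) : ∇u_{p'''} = ∑ (u_{p'})ᵢ (u_{p''})ⱼ ∂ᵢ (u_{p'''})ⱼ`. -/
def interaction (χ : E3 → ℝ) (L : ℝ) (u : ℝ → E3 → E3) (P : ℤ × ℤ × ℤ) (z : ℝ × E3) : ℝ :=
  inner ℝ (block χ L P.2.1 (u z.1) z.2)
    (fderiv ℝ (block χ L P.2.2 (u z.1)) z.2 (block χ L P.1 (u z.1) z.2))

/-- The energy flux density `π_q`. -/
def fluxDensity (χ : E3 → ℝ) (L : ℝ) (u : ℝ → E3 → E3) (q : ℕ) (z : ℝ × E3) : ℝ :=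
  ∑' P : fluxIndex q, interaction χ L u P z

/-- `⟨|π_p| restricted to Ω_T \ G⟩`. -/
def fluxOff (χ : E3 → ℝ) (L T : ℝ) (u : ℝ → E3 → E3) (G : Set (ℝ × E3)) (p : ℕ) : ℝ :=
  avg L T (Gᶜ.indicator (fun z => |fluxDensity χ L u p z|))

/-- The energy flux of `u` concentrates on `G ⊆ Ω_T`: there is a decreasing sequence of
(relatively) open subsets of `Ω_T` with intersection `G` such that for each of them the part of
the flux density off that set tends to zero in the mean. -/
def FluxConcentratesOn (χ : E3 → ℝ) (L T : ℝ) (u : ℝ → E3 → E3) (G : Set (ℝ × E3)) : Prop :=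
  MeasurableSet G ∧ ∃ Gs : ℕ → Set (ℝ × E3),
    Antitone Gs ∧
    (∀ q, ∃ U : Set (ℝ × E3), IsOpen U ∧ Gs q = U ∩ slab T) ∧
    (∀ q t, Periodic L (fun x => (t, x) ∈ Gs q)) ∧
    G = ⋂ q, Gs q ∧
    ∀ q, Tendsto (fun p => fluxOff χ L T u (Gs q) p) atTop (𝓝 0)

/-! ### Active regions -/

/-- The dyadic cube `Q_{qk} = [0, ℓ_q)³ + ℓ_q k` of the torus, `ℓ_q = L / 2^q`, as a periodic
set. It depends only on `k` modulo `2^q`. -/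
def dyadicCube (L : ℝ) (q : ℕ) (k : Fin 3 → ℤ) : Set E3 :=
  {x | ∃ m : Fin 3 → ℤ, ∀ i,
    x i - L * m i ∈ Ico (L / 2 ^ q * (k i : ℝ)) (L / 2 ^ q * ((k i : ℝ) + 1))}

/-- The dilated cube `Q*_{qk}`, the union of the cubes `Q_{qk'}` with `|k' - k| < 3`. -/
def dilatedCube (L : ℝ) (q : ℕ) (k : Fin 3 → ℤ) : Set E3 :=
  ⋃ k' ∈ {k' : Fin 3 → ℤ | ∑ i, (k' i - k i) ^ 2 < 9}, dyadicCube L q k'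

/-- The interior of the dilated cube. -/
def openDilatedCube (L : ℝ) (q : ℕ) (k : Fin 3 → ℤ) : Set E3 := interior (dilatedCube L q k)

/-- Smooth mollifiers of integral one supported in the unit ball. -/
structure IsMollifier (η : E3 → ℝ) : Prop where
  smooth : ContDiff ℝ ∞ η
  supp : Function.support η ⊆ Metric.ball 0 1
  integral_eq_one : ∫ x, η x = 1

/-- The mollified characteristic function `χ_{Q_{qk}} ⋆ η_q`, `η_q(x) = 2^{3q} η(λ_q x)`, where
`⋆` is the convolution on the torus with respect to normalized Lebesgue measure. -/
def smoothCube (η : E3 → ℝ) (L : ℝ) (q : ℕ) (k : Fin 3 → ℤ) (x : E3) : ℝ :=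
  (L ^ 3)⁻¹ * ∫ y, (dyadicCube L q k).indicator (fun _ => (1 : ℝ)) y *
    (2 ^ (3 * q) * η (waveNumber L q • (x - y)))

/-- The partial derivative in the direction of the `i`-th coordinate. -/
def pderiv (i : Fin 3) (g : E3 → E3) (x : E3) : E3 := fderiv ℝ g x (e i)

/-- The mixed partial derivative `∂^β`. -/
def multiDeriv (β : Fin 3 → ℕ) (g : E3 → E3) : E3 → E3 :=
  (pderiv 0)^[β 0] ((pderiv 1)^[β 1] ((pderiv 2)^[β 2] g))

/-- The atomic coefficient
`s_{qk}(t) = max_{|β| ≤ M} λ_q^{-|β|} ‖∂^β (u_q(t) χ'_{qk})‖_∞`. -/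
def atomCoeff (χ η : E3 → ℝ) (M : ℕ) (L : ℝ) (u : ℝ → E3 → E3) (q : ℕ) (k : Fin 3 → ℤ)
    (t : ℝ) : ℝ :=
  ⨆ β : {β : Fin 3 → ℕ // ∑ i, β i ≤ M},
    (waveNumber L q ^ (∑ i, β.1 i))⁻¹ *
      ⨆ x : E3, ‖multiDeriv β.1 (fun y => smoothCube η L q k y • block χ L q (u t) y) x‖

/-- Admissible sequences `σ_q`: positive, decreasing to zero, with zero exponential type. -/
structure IsThreshold (σ : ℕ → ℝ) : Prop where
  pos : ∀ q, 0 < σ q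
  antitone : Antitone σ
  tendsto_zero : Tendsto σ atTop (𝓝 0)
  zero_type : Tendsto (fun q : ℕ => Real.log (σ q) / q) atTop (𝓝 0)

/-- The active region `A_q`, with the cubes `D q k` as the eddies: the points `(t, x)` of `Ω_T`
such that `x` lies in `D q k` for some index `k ∈ [0, 2^q - 1]³` with
`s_{qk}(t) > σ_q ⟨|u_q|³⟩ / ⟨|u_q|²⟩`. (If `u_q` vanishes, the region is empty.) -/
def activeRegion (D : ℕ → (Fin 3 → ℤ) → Set E3) (χ η : E3 → ℝ) (M : ℕ) (σ : ℕ → ℝ) (L T : ℝ)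
    (u : ℝ → E3 → E3) (q : ℕ) : Set (ℝ × E3) :=
  {z | z.1 ∈ Icc (0 : ℝ) T ∧ ∃ k : Fin 3 → ℤ, (∀ i, 0 ≤ k i ∧ k i ≤ 2 ^ q - 1) ∧
    σ q * (moment χ L T u 3 q / moment χ L T u 2 q) < atomCoeff χ η M L u q k z.1 ∧
    z.2 ∈ D q k}

end EulerFlux

end

/-! The flux is a sum of trilinear terms, each controlled by Hölder's inequality with three `L³`
factors: two blocks of index at least `p - 1` and the gradient of a block of index below `p`.
Finiteness of ε says that the space-time `L³` norm of `u_q` is at most a constant times `r^q`, where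
`r = 2^(-1/3)` is `blockRatio`. By Bernstein's inequality (`eLpNorm_pderiv_block_le`) the gradient
of the block `p'''` costs `2^p''' r^p''' = r^(-2p''')`. The exponents of the three factors then
depend only on the distances of the indices from `p`, and the sum is a product of geometric series,
bounded uniformly in `p` (`tsum_lintegral_interaction_le`). This gives absolute convergence almost
everywhere and integrability.

Localization gains a small factor. The functions χ'_{qk} form a partition of unity with at most 27
nonzero members at each point, each vanishing outside the interior of Q*_{qk}. Off the active region
every product χ'_{qk} u_q at the point is therefore below the threshold, and |u_q| ≤ 27 σ_q
⟨|u_q|³⟩/⟨|u_q|²⟩ (`norm_block_le_of_notMem_activeRegion`). Bounding one of the three factors of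
|u_q|³ in this way and integrating |u_q|² over the whole cylinder leaves 27 σ_q ⟨|u_q|³⟩
(`eLpNorm_block_off_le`). Off all active regions of index at least `q`, both high-frequency factors
of `π_p` thus carry an extra `(27 σ_{p-1})^(1/3)`, which tends to zero (`tendsto_fluxOff`).

The coefficients s_{qk} are suprema of functions continuous in time, so their superlevel sets are
relatively open, and so are the regions built from interiors of cubes
(`exists_isOpen_activeRegion`). Cubes and their interiors differ only on faces, which are null.

Bernstein's inequality comes from an exact quadrature: the derivative of a trigonometric polynomial
of degree `N` is a combination of translates with total weight O(N), and translations preserve the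
norm on the torus. -/

noncomputable section

namespace EulerFlux

/-! ### Bernstein's inequality: a quadrature formula for the derivative -/

/-- Orthogonality of characters on the `M`-th roots of unity. -/
theorem sum_exp_nodes (M : ℕ) (m : ℤ) (hm : |m| < M) :
    ∑ j ∈ Finset.range M, Complex.exp (Complex.I * m * ((2 * Real.pi * j / M : ℝ) : ℂ))
      = if m = 0 then (M : ℂ) else 0 := by
  have hM : 0 < (M : ℤ) := lt_of_le_of_lt (abs_nonneg m) hm
  have hM' : (M : ℂ) ≠ 0 := by exact_mod_cast hM.ne'
  split_ifs with h
  · simp [h]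
  · set ζ : ℂ := Complex.exp (2 * Real.pi * Complex.I * (m / M)) with hζ
    have h1 : ∀ j ∈ Finset.range M,
        Complex.exp (Complex.I * m * ((2 * Real.pi * j / M : ℝ) : ℂ)) = ζ ^ j := by
      intro j _
      rw [hζ, ← Complex.exp_nat_mul]
      congr 1
      push_cast
      ring
    rw [Finset.sum_congr rfl h1]
    have h2 : ζ ^ M = 1 := by
      rw [hζ, ← Complex.exp_nat_mul, Complex.exp_eq_one_iff]
      exact ⟨m, by field_simp⟩
    have h3 : ζ ≠ 1 := by
      intro h3
      rw [hζ, Complex.exp_eq_one_iff] at h3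
      obtain ⟨n, hn⟩ := h3
      have h4 : (m : ℂ) = n * M := by
        have : (2 * Real.pi * Complex.I : ℂ) ≠ 0 := Complex.two_pi_I_ne_zero
        have h5 : (m / M : ℂ) = n := by
          apply mul_left_cancel₀ this
          rw [hn]; ring
        rw [← h5]; field_simp
      have h5 : m = n * M := by exact_mod_cast h4
      have h6 : m = 0 := Int.eq_zero_of_abs_lt_dvd ⟨n, by rw [h5]; ring⟩ hm
      exact h h6
    have h4 := mul_neg_geom_sum ζ M
    rw [h2, sub_self] at h4
    exact (mul_eq_zero.mp h4).resolve_left (sub_ne_zero.mpr (Ne.symm h3))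

/-- The Dirichlet sum at `t`. -/
def dirichletSum (N : ℕ) (t : ℝ) : ℂ :=
  ∑ a ∈ Finset.Ico (0 : ℤ) N, Complex.exp (Complex.I * a * (t : ℂ))

theorem normSq_dirichletSum (N : ℕ) (t : ℝ) :
    ((‖dirichletSum N t‖ ^ 2 : ℝ) : ℂ) = ∑ a ∈ Finset.Ico (0 : ℤ) N, ∑ b ∈ Finset.Ico (0 : ℤ) N,
      Complex.exp (Complex.I * ((a - b : ℤ) : ℂ) * (t : ℂ)) := by
  have : ((‖dirichletSum N t‖ ^ 2 : ℝ) : ℂ)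
      = dirichletSum N t * (starRingEnd ℂ) (dirichletSum N t) := by
    rw [Complex.mul_conj, Complex.normSq_eq_norm_sq]
  rw [this, dirichletSum, map_sum, Finset.sum_mul_sum]
  refine Finset.sum_congr rfl fun a _ => Finset.sum_congr rfl fun b _ => ?_
  rw [← Complex.exp_conj, ← Complex.exp_add]
  congr 1
  simp
  ring

/-- For fixed `a` there is a solution `b = a + m` exactly when it lies in `[0, N)`, so the count is
the length of an intersection of two intervals. This triangle function is the Fourier transform of
the Fejér kernel. -/
theorem card_pairs (N : ℕ) (m : ℤ) :
    ∑ a ∈ Finset.Ico (0 : ℤ) N, ∑ b ∈ Finset.Ico (0 : ℤ) N,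
      (if m + (a - b) = 0 then (1 : ℂ) else 0) = ((max 0 ((N : ℤ) - |m|) : ℤ) : ℂ) := by
  have h1 : ∀ a ∈ Finset.Ico (0 : ℤ) N, ∑ b ∈ Finset.Ico (0 : ℤ) N,
      (if m + (a - b) = 0 then (1 : ℂ) else 0) = if a ∈ Finset.Ico (-m) (N - m) then 1 else 0 := by
    intro a _
    have : ∀ b, (m + (a - b) = 0) ↔ (a + m = b) := fun b => by omega
    simp only [this, Finset.sum_ite_eq, Finset.mem_Ico]
    congr 1
    apply propext
    omega
  rw [Finset.sum_congr rfl h1, Finset.sum_boole, Finset.filter_mem_eq_inter,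
    Finset.Ico_inter_Ico, Int.card_Ico]
  have : (((min (N : ℤ) (N - m) - max 0 (-m)).toNat : ℤ)) = max 0 ((N : ℤ) - |m|) := by
    rcases abs_cases m with h | h <;> omega
  rw [← this]
  push_cast
  rfl

/-- The discrete Fourier coefficients of the Fejér kernel. -/
theorem sum_fejer (N M : ℕ) (m : ℤ) (hm : |m| + N ≤ M) :
    ∑ j ∈ Finset.range M, ((‖dirichletSum N (2 * Real.pi * j / M)‖ ^ 2 : ℝ) : ℂ) *
      Complex.exp (Complex.I * m * ((2 * Real.pi * j / M : ℝ) : ℂ))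
      = M * ((max 0 ((N : ℤ) - |m|) : ℤ) : ℂ) := by
  rw [← card_pairs]
  simp only [normSq_dirichletSum, Finset.sum_mul, ← Complex.exp_add, Finset.mul_sum]
  rw [Finset.sum_comm]
  refine Finset.sum_congr rfl fun a ha => ?_
  rw [Finset.sum_comm]
  refine Finset.sum_congr rfl fun b hb => ?_
  rw [Finset.mem_Ico] at ha hb
  -- No aliasing: `|a - b| ≤ N - 1`, so `|m + (a - b)| < |m| + N ≤ M`.
  have := sum_exp_nodes M (m + (a - b)) (by
    rcases abs_cases (m + (a - b)) with h | h <;> rcases abs_cases m with h' | h' <;> omega)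
  rw [mul_ite, mul_one, mul_zero, ← this]
  refine Finset.sum_congr rfl fun j _ => ?_
  congr 1
  push_cast
  ring

/-- A quadrature formula which computes derivatives of trigonometric polynomials of degree at
most `N`, with weights of total mass at most `2 N`. -/
theorem exists_derivative_quadrature (N : ℕ) (hN : 0 < N) :
    ∃ (M : ℕ) (c t : ℕ → ℝ), ∑ j ∈ Finset.range M, |c j| ≤ 2 * N ∧
      ∀ k : ℤ, |k| ≤ N → ∑ j ∈ Finset.range M,
        (c j : ℂ) * Complex.exp (Complex.I * k * (t j : ℂ)) = Complex.I * k := by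
  -- The frequencies `k ± N` reach `2N` in modulus and the Fejér kernel needs `N` more, hence `3N`
  -- nodes.
  set M : ℕ := 3 * N with hM
  have hM0 : (M : ℝ) ≠ 0 := by positivity
  have hM0' : (M : ℂ) ≠ 0 := by exact_mod_cast hM0
  set t : ℕ → ℝ := fun j => 2 * Real.pi * j / M with ht
  refine ⟨M, fun j => (M : ℝ)⁻¹ * (2 * Real.sin (N * t j)) * ‖dirichletSum N (t j)‖ ^ 2, t,
    ?_, ?_⟩
  · have h0 := sum_fejer N M 0 (by simp [hM]; omega)
    simp only [Int.cast_zero, mul_zero, zero_mul, Complex.exp_zero, mul_one, abs_zero,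
      sub_zero] at h0
    have h1 : ∑ j ∈ Finset.range M, ‖dirichletSum N (t j)‖ ^ 2 = M * N := by
      have : (max 0 (N : ℤ)) = N := by omega
      rw [this] at h0
      exact_mod_cast h0
    calc _ ≤ ∑ j ∈ Finset.range M, (M : ℝ)⁻¹ * 2 * ‖dirichletSum N (t j)‖ ^ 2 := by
          refine Finset.sum_le_sum fun j _ => ?_
          rw [abs_mul, abs_mul, abs_mul, abs_of_nonneg (by positivity : (0 : ℝ) ≤ (M : ℝ)⁻¹),
            abs_of_nonneg (by positivity : (0 : ℝ) ≤ ‖dirichletSum N (t j)‖ ^ 2), abs_two]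
          gcongr
          nlinarith [Real.abs_sin_le_one (N * t j)]
      _ = 2 * (N : ℝ) := by
          rw [← Finset.mul_sum, h1]; field_simp
  · intro k hk
    -- The factor `2 sin(Nt) = i(e^{-iNt} - e^{iNt})` turns the sum into `i` times a difference of
    -- Fejér coefficients at `k - N` and `k + N`.
    have hs : ∀ j, (((M : ℝ)⁻¹ * (2 * Real.sin (N * t j)) * ‖dirichletSum N (t j)‖ ^ 2 : ℝ) : ℂ) *
        Complex.exp (Complex.I * k * (t j : ℂ)) = (M : ℂ)⁻¹ * Complex.I *
        (((‖dirichletSum N (t j)‖ ^ 2 : ℝ) : ℂ) *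
            Complex.exp (Complex.I * ((k - N : ℤ) : ℂ) * (t j : ℂ)) -
          ((‖dirichletSum N (t j)‖ ^ 2 : ℝ) : ℂ) *
            Complex.exp (Complex.I * ((k + N : ℤ) : ℂ) * (t j : ℂ))) := by
      intro j
      have e1 : Complex.exp (Complex.I * ((k - N : ℤ) : ℂ) * (t j : ℂ)) =
          Complex.exp (Complex.I * k * (t j : ℂ)) *
            Complex.exp (-((N * t j : ℂ)) * Complex.I) := by
        rw [← Complex.exp_add]; congr 1; push_cast; ring
      have e2 : Complex.exp (Complex.I * ((k + N : ℤ) : ℂ) * (t j : ℂ)) =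
          Complex.exp (Complex.I * k * (t j : ℂ)) *
            Complex.exp (((N * t j : ℂ)) * Complex.I) := by
        rw [← Complex.exp_add]; congr 1; push_cast; ring
      rw [e1, e2]
      push_cast
      rw [Complex.sin]
      ring
    rw [Finset.sum_congr rfl fun j _ => hs j, ← Finset.mul_sum, Finset.sum_sub_distrib,
      sum_fejer N M (k - N) (by
        rcases abs_cases k with h | h <;>
        rcases abs_cases (k - (N : ℤ)) with h' | h' <;> push_cast [hM] <;> omega),
      sum_fejer N M (k + N) (by
        rcases abs_cases k with h | h <;>
        rcases abs_cases (k + (N : ℤ)) with h' | h' <;> push_cast [hM] <;> omega)]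
    -- The difference of the triangles centred at `N` and `-N` is the identity function on `[-N,
    -- N]`.
    have h2 : (max 0 ((N : ℤ) - |k - N|) : ℤ) = k + (max 0 ((N : ℤ) - |k + N|) : ℤ) := by
      rcases abs_cases k with h | h <;> rcases abs_cases (k - (N : ℤ)) with h' | h' <;>
        rcases abs_cases (k + (N : ℤ)) with h'' | h'' <;> omega
    rw [h2]
    push_cast
    field_simp
    ring

/-! ### Periodic functions -/

theorem Periodic.add_lattice {F : Type} {L : ℝ} {g : E3 → F} (hg : Periodic L g) (x : E3)
    (m : Fin 3 → ℤ) : g (x + L • WithLp.toLp 2 (fun i => (m i : ℝ))) = g x := by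
  have h : ∀ i, Function.Periodic g (L • e i) := fun i x => hg x i
  have h3 : Function.Periodic g (m 0 • (L • e 0) + (m 1 • (L • e 1) + m 2 • (L • e 2))) :=
    ((h 0).zsmul (m 0)).add_period (((h 1).zsmul (m 1)).add_period ((h 2).zsmul (m 2)))
  rw [← h3 x]
  congr 2
  ext i
  fin_cases i <;> simp [e] <;> ring

/-- The representative in the box of a point modulo the lattice. -/
theorem exists_lattice_add_mem_box {L : ℝ} (hL : 0 < L) (x : E3) :
    ∃ m : Fin 3 → ℤ, x + L • WithLp.toLp 2 (fun i => (m i : ℝ)) ∈ box L := by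
  refine ⟨fun i => -⌊x i / L⌋, fun i => ?_⟩
  have h1 := Int.floor_le (x i / L)
  have h2 := Int.lt_floor_add_one (x i / L)
  rw [le_div_iff₀ hL] at h1
  rw [div_lt_iff₀ hL] at h2
  simp only [PiLp.add_apply, PiLp.smul_apply, smul_eq_mul, mem_Ico, Int.cast_neg]
  constructor <;> linarith

theorem isBounded_box (L : ℝ) : Bornology.IsBounded (box L) := by
  refine (Metric.isBounded_closedBall (x := (0 : E3)) (r := √(3 * L ^ 2))).subset fun x hx => ?_
  rw [mem_closedBall_zero_iff, EuclideanSpace.norm_eq]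
  refine Real.sqrt_le_sqrt ?_
  have h : ∀ i, ‖x i‖ ^ 2 ≤ L ^ 2 := fun i => by
    rw [Real.norm_eq_abs, sq_abs]
    exact pow_le_pow_left₀ (hx i).1 (hx i).2.le 2
  rw [Fin.sum_univ_three]
  linarith [h 0, h 1, h 2]

/-- A continuous periodic function is bounded. -/
theorem Periodic.exists_norm_le {F : Type} [SeminormedAddCommGroup F] {L : ℝ} (hL : 0 < L)
    {g : E3 → F} (hg : Periodic L g) (hc : Continuous g) : ∃ C, ∀ x, ‖g x‖ ≤ C := by
  obtain ⟨C, hC⟩ := (isBounded_box L).isCompact_closure.exists_bound_of_continuousOn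
    hc.continuousOn
  refine ⟨C, fun x => ?_⟩
  obtain ⟨m, hm⟩ := exists_lattice_add_mem_box hL x
  rw [← hg.add_lattice x m]
  exact hC _ (subset_closure hm)

theorem Periodic.comp {F G : Type} {L : ℝ} {g : E3 → F} (hg : Periodic L g) (φ : F → G) :
    Periodic L (fun x => φ (g x)) := fun x i => congrArg φ (hg x i)

/-! ### The period box and the cylinder: measure, translations, integrability -/

theorem measurableSet_box (L : ℝ) : MeasurableSet (box L) := by
  have : box L = ⋂ i, (fun x : E3 => x i) ⁻¹' Ico 0 L := by ext x; simp [box]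
  rw [this]
  refine MeasurableSet.iInter fun i => measurableSet_Ico.preimage ?_
  fun_prop

theorem volume_box_lt_top (L : ℝ) : volume (box L) < ⊤ := (isBounded_box L).measure_lt_top

theorem measurableSet_cylinder (L T : ℝ) : MeasurableSet (cylinder L T) :=
  measurableSet_Icc.prod (measurableSet_box L)

theorem cylinder_subset_slab (L T : ℝ) : cylinder L T ⊆ slab T :=
  prod_mono_right (subset_univ _)

theorem measurableSet_slab (T : ℝ) : MeasurableSet (slab T) :=
  measurableSet_Icc.prod MeasurableSet.univ

theorem restrict_cylinder (L T : ℝ) : (volume : Measure (ℝ × E3)).restrict (cylinder L T)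
    = (volume.restrict (Icc 0 T)).prod (volume.restrict (box L)) :=
  (Measure.prod_restrict _ _).symm

/-- The basis of the lattice of periods. -/
def periodBasis {L : ℝ} (hL : 0 < L) : Module.Basis (Fin 3) ℝ E3 :=
  (EuclideanSpace.basisFun (Fin 3) ℝ).toBasis.isUnitSMul (fun _ => hL.ne'.isUnit)

theorem periodBasis_apply {L : ℝ} (hL : 0 < L) (i : Fin 3) : periodBasis hL i = L • e i := by
  rw [periodBasis, Module.Basis.isUnitSMul_apply]
  simp [e]

theorem fundamentalDomain_periodBasis {L : ℝ} (hL : 0 < L) :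
    ZSpan.fundamentalDomain (periodBasis hL) = box L := by
  ext x
  rw [ZSpan.mem_fundamentalDomain]
  refine forall_congr' fun i => ?_
  have : (periodBasis hL).repr x i = x i / L := by
    rw [periodBasis, Module.Basis.repr_isUnitSMul]
    simp [Units.smul_def]
    ring
  rw [this, mem_Ico, mem_Ico, div_lt_one hL, le_div_iff₀ hL, zero_mul]

/-- Passes from the three generators to the whole lattice, the form of invariance required by
integration over fundamental domains. -/
theorem Periodic.vadd_eq {F : Type} {L : ℝ} (hL : 0 < L) {g : E3 → F} (hg : Periodic L g)
    (v : (Submodule.span ℤ (Set.range (periodBasis hL))).toAddSubgroup) (x : E3) : g (v +ᵥ x) = g x := by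
  obtain ⟨v, hv⟩ := v
  change g (v + x) = g x
  have : Function.Periodic g v := by
    rw [Submodule.mem_toAddSubgroup] at hv
    induction hv using Submodule.span_induction with
    | mem v hv =>
      obtain ⟨i, rfl⟩ := hv
      rw [periodBasis_apply]
      exact fun x => hg x i
    | zero => exact fun x => by rw [add_zero]
    | add v w _ _ h1 h2 => exact h1.add_period h2
    | smul a v _ h => exact h.zsmul a
  rw [add_comm, this x]

/-- Integrals over a period are invariant under translations. -/
theorem Periodic.lintegral_box_add {L : ℝ} (hL : 0 < L) {g : E3 → ENNReal} (hg : Periodic L g)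
    (h : E3) : ∫⁻ x in box L, g (x + h) = ∫⁻ x in box L, g x := by
  have h1 := ZSpan.isAddFundamentalDomain' (periodBasis hL) (volume : Measure E3)
  rw [fundamentalDomain_periodBasis] at h1
  -- The translate of the box by `h` is another fundamental domain, over which an invariant function
  -- has the same integral.
  have h2 := h1.vadd_of_comm h
  have : Countable (Submodule.span ℤ (Set.range (periodBasis hL))).toAddSubgroup :=
    inferInstanceAs (Countable (Submodule.span ℤ (Set.range (periodBasis hL))))
  have h3 := h1.setLIntegral_eq h2 g (hg.vadd_eq hL)
  rw [h3]
  have h4 : (fun x => g (x + h)) = fun x => g (h +ᵥ x) := by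
    funext x
    rw [vadd_eq_add, add_comm]
  rw [h4]
  have h5 := (measurePreserving_vadd h (volume : Measure E3)).setLIntegral_comp_emb
    (measurableEmbedding_const_vadd h) g (box L)
  rw [h5]
  rfl

/-- Space-time functions that are continuous on the slab are measurable on the cylinder. -/
theorem aestronglyMeasurable_of_slab {F : Type} [NormedAddCommGroup F]
    [SecondCountableTopology F] {L T : ℝ} {g : ℝ × E3 → F} (hg : ContinuousOn g (slab T)) :
    AEStronglyMeasurable g (volume.restrict (cylinder L T)) :=
  (hg.mono (cylinder_subset_slab L T)).aestronglyMeasurable (measurableSet_cylinder L T)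

theorem continuousOn_translate {F : Type} [TopologicalSpace F] {T : ℝ} {g : ℝ × E3 → F}
    (hg : ContinuousOn g (slab T)) (h : E3) :
    ContinuousOn (fun z : ℝ × E3 => g (z.1, z.2 + h)) (slab T) :=
  hg.comp (by fun_prop) fun _ hz => ⟨hz.1, mem_univ _⟩

/-- Space-time norms of spatially periodic functions are invariant under translations. -/
theorem eLpNorm_cylinder_translate {F : Type} [NormedAddCommGroup F]
    [SecondCountableTopology F] {L T : ℝ} (hL : 0 < L) {g : ℝ × E3 → F}
    (hg : ContinuousOn g (slab T)) (hp : ∀ t ∈ Icc 0 T, Periodic L (fun x => g (t, x))) (h : E3) :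
    eLpNorm (fun z : ℝ × E3 => g (z.1, z.2 + h)) 3 (volume.restrict (cylinder L T))
      = eLpNorm g 3 (volume.restrict (cylinder L T)) := by
  rw [eLpNorm_eq_lintegral_rpow_enorm_toReal (by norm_num) (by norm_num),
    eLpNorm_eq_lintegral_rpow_enorm_toReal (by norm_num) (by norm_num)]
  congr 1
  have m1 := (aestronglyMeasurable_of_slab (L := L)
    (continuousOn_translate hg h)).enorm.pow_const (ENNReal.toReal 3)
  have m2 := (aestronglyMeasurable_of_slab (L := L) hg).enorm.pow_const (ENNReal.toReal 3)
  rw [restrict_cylinder] at m1 m2 ⊢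
  rw [lintegral_prod _ m1, lintegral_prod _ m2]
  refine setLIntegral_congr_fun measurableSet_Icc fun t ht => ?_
  exact Periodic.lintegral_box_add hL
    ((hp t ht).comp fun y => ‖y‖ₑ ^ (ENNReal.toReal 3)) h

/-- The box is half-open, so compactness is applied to its closure, which still lies over the slab.
-/
theorem exists_norm_le_of_slab {F : Type} [SeminormedAddCommGroup F] {T : ℝ} (L : ℝ)
    {g : ℝ × E3 → F} (hg : ContinuousOn g (slab T)) : ∃ C, ∀ z ∈ cylinder L T, ‖g z‖ ≤ C := by
  have hK : IsCompact (Icc (0 : ℝ) T ×ˢ closure (box L)) :=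
    isCompact_Icc.prod (isBounded_box L).isCompact_closure
  obtain ⟨C, hC⟩ := hK.exists_bound_of_continuousOn (hg.mono (prod_mono_right (subset_univ _)))
  exact ⟨C, fun z hz => hC z ⟨hz.1, subset_closure hz.2⟩⟩

theorem volume_cylinder_lt_top (L T : ℝ) : volume (cylinder L T) < ⊤ := by
  rw [cylinder, Measure.volume_eq_prod, Measure.prod_prod]
  exact ENNReal.mul_lt_top measure_Icc_lt_top (volume_box_lt_top L)

theorem integrableOn_cylinder_of_slab {F : Type} [NormedAddCommGroup F]
    [SecondCountableTopology F] {T : ℝ} (L : ℝ) {g : ℝ × E3 → F} (hg : ContinuousOn g (slab T)) :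
    IntegrableOn g (cylinder L T) := by
  obtain ⟨C, hC⟩ := exists_norm_le_of_slab L hg
  exact IntegrableOn.of_bound (volume_cylinder_lt_top L T) (aestronglyMeasurable_of_slab hg) C
    (ae_restrict_of_forall_mem (measurableSet_cylinder L T) hC)

/-! ### Trigonometric polynomials -/

/-- The phase `2π k·x` of the lattice frequency `k = n / L`. -/
def phase (L : ℝ) (n : Fin 3 → ℤ) : E3 →L[ℝ] ℝ := (2 * Real.pi) • innerSL ℝ (freq L n)

theorem phase_e (L : ℝ) (n : Fin 3 → ℤ) (i : Fin 3) :
    phase L n (e i) = 2 * Real.pi / L * n i := by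
  simp [phase, e, freq, EuclideanSpace.inner_single_right]
  ring

theorem character_freq (L : ℝ) (n : Fin 3 → ℤ) (x : E3) :
    character (freq L n) x = Complex.exp ((phase L n x : ℂ) * Complex.I) := by
  simp [character, phase]
  ring_nf

theorem character_neg_freq (L : ℝ) (n : Fin 3 → ℤ) (x : E3) :
    character (-freq L n) x = Complex.exp (((-phase L n x : ℝ) : ℂ) * Complex.I) := by
  simp [character, phase]
  ring_nf

/-- Vector valued trigonometric polynomials with spectrum in `S`. -/
def trigField (L : ℝ) (S : Finset (Fin 3 → ℤ)) (A B : (Fin 3 → ℤ) → E3) (x : E3) : E3 :=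
  ∑ n ∈ S, (Real.cos (phase L n x) • A n - Real.sin (phase L n x) • B n)

theorem contDiff_trigField (L : ℝ) (S : Finset (Fin 3 → ℤ)) (A B : (Fin 3 → ℤ) → E3) :
    ContDiff ℝ ∞ (trigField L S A B) := by
  unfold trigField
  refine ContDiff.sum fun n _ => ?_
  have h := (phase L n).contDiff (n := ∞)
  exact ((Real.contDiff_cos.comp h).smul contDiff_const).sub
    ((Real.contDiff_sin.comp h).smul contDiff_const)

theorem phase_add_smul_e (L : ℝ) (n : Fin 3 → ℤ) (x : E3) (s : ℝ) (i : Fin 3) :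
    phase L n (x + s • e i) = phase L n x + n i * (2 * Real.pi / L * s) := by
  rw [map_add, map_smul, phase_e, smul_eq_mul]
  ring

theorem periodic_trigField {L : ℝ} (hL : 0 < L) (S : Finset (Fin 3 → ℤ))
    (A B : (Fin 3 → ℤ) → E3) : Periodic L (trigField L S A B) := by
  intro x i
  refine Finset.sum_congr rfl fun n _ => ?_
  have : phase L n x + n i * (2 * Real.pi / L * L) = phase L n x + n i * (2 * Real.pi) := by
    field_simp
  rw [phase_add_smul_e, this, Real.cos_add_int_mul_two_pi, Real.sin_add_int_mul_two_pi]

theorem pderiv_trigField (L : ℝ) (S : Finset (Fin 3 → ℤ)) (A B : (Fin 3 → ℤ) → E3) (i : Fin 3)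
    (x : E3) : pderiv i (trigField L S A B) x = (2 * Real.pi / L) • ∑ n ∈ S,
      (-(n i * Real.sin (phase L n x)) • A n - (n i * Real.cos (phase L n x)) • B n) := by
  have h : HasFDerivAt (trigField L S A B)
      (∑ n ∈ S, (((-Real.sin (phase L n x)) • phase L n).smulRight (A n) -
        ((Real.cos (phase L n x)) • phase L n).smulRight (B n))) x := by
    unfold trigField
    refine HasFDerivAt.fun_sum fun n _ => ?_
    have h := (phase L n).hasFDerivAt (x := x)
    exact (h.cos.smul_const (A n)).sub (h.sin.smul_const (B n))
  rw [pderiv, h.fderiv]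
  simp only [sum_apply, sub_apply,
    ContinuousLinearMap.smulRight_apply, smul_apply, phase_e, Finset.smul_sum]
  refine Finset.sum_congr rfl fun n _ => ?_
  simp only [smul_sub, smul_smul, smul_eq_mul]
  congr 2 <;> ring

/-- The derivative of a trigonometric polynomial is a combination of its translates. -/
theorem exists_pderiv_eq_sum_translates {L : ℝ} (hL : 0 < L) (N : ℕ) (hN : 0 < N) :
    ∃ (M : ℕ) (c τ : ℕ → ℝ), ∑ j ∈ Finset.range M, |c j| ≤ 4 * Real.pi / L * N ∧
      ∀ (S : Finset (Fin 3 → ℤ)), (∀ n ∈ S, ∀ i, |n i| ≤ (N : ℤ)) →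
      ∀ (A B : (Fin 3 → ℤ) → E3) (i : Fin 3) (x : E3), pderiv i (trigField L S A B) x
        = ∑ j ∈ Finset.range M, c j • trigField L S A B (x + τ j • e i) := by
  obtain ⟨M, c, t, hc, hq⟩ := exists_derivative_quadrature N hN
  -- Along `e i` the frequency `n` oscillates as `n i * (2π/L) s`. Rescaling nodes by `L/(2π)` and
  -- weights by `2π/L` reduces to one variable, with the same nodes for all fields and directions.
  refine ⟨M, fun j => 2 * Real.pi / L * c j, fun j => L * t j / (2 * Real.pi), ?_, ?_⟩
  · have : ∀ j, |2 * Real.pi / L * c j| = 2 * Real.pi / L * |c j| := fun j => by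
      rw [abs_mul, abs_of_nonneg (by positivity)]
    simp only [this, ← Finset.mul_sum]
    calc _ ≤ 2 * Real.pi / L * (2 * N) := by gcongr
      _ = 4 * Real.pi / L * (N : ℝ) := by ring
  · intro S hS A B i x
    rw [pderiv_trigField]
    simp only [mul_smul, ← Finset.smul_sum]
    congr 1
    simp only [trigField, Finset.smul_sum]
    rw [Finset.sum_comm]
    refine Finset.sum_congr rfl fun n hn => ?_
    have hph : ∀ j, phase L n (x + (L * t j / (2 * Real.pi)) • e i)
        = phase L n x + n i * t j := fun j => by
      rw [phase_add_smul_e]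
      field_simp
    -- The real part of this identity handles the cosine coefficients, the imaginary part the sine
    -- coefficients.
    have key : ∑ j ∈ Finset.range M, (c j : ℂ) *
        Complex.exp (((phase L n x + n i * t j : ℝ) : ℂ) * Complex.I)
        = Complex.exp ((phase L n x : ℂ) * Complex.I) * (Complex.I * n i) := by
      rw [← hq (n i) (hS n hn i), Finset.mul_sum]
      refine Finset.sum_congr rfl fun j _ => ?_
      rw [mul_left_comm, ← Complex.exp_add]
      congr 2
      push_cast
      ring
    have kre := congrArg Complex.re key
    have kim := congrArg Complex.im key
    rw [Complex.re_sum] at kre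
    rw [Complex.im_sum] at kim
    simp only [Complex.mul_re, Complex.mul_im, Complex.ofReal_re, Complex.ofReal_im, zero_mul,
      sub_zero, add_zero, Complex.exp_ofReal_mul_I_re, Complex.exp_ofReal_mul_I_im, Complex.I_re,
      Complex.I_im, Complex.intCast_re, Complex.intCast_im, one_mul, zero_sub, zero_add, mul_zero] at kre kim
    simp only [hph, smul_sub, smul_smul, Finset.sum_sub_distrib, ← Finset.sum_smul, kre, kim]
    congr 2 <;> ring

/-! ### Littlewood-Paley blocks as trigonometric polynomials -/

theorem IsCutoff.eq_zero {χ : E3 → ℝ} (hχ : IsCutoff χ) {ξ : E3} (h : 1 ≤ ‖ξ‖) : χ ξ = 0 := by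
  by_contra h0
  have := hχ.supp (subset_tsupport _ h0)
  rw [mem_ball_zero_iff] at this
  linarith

/-- The degree of the block of index `q`. -/
def blockDegree (q : ℤ) : ℕ := 2 ^ (q + 1).toNat

/-- The frequencies of the block of index `q`. -/
def blockFreqs (q : ℤ) : Finset (Fin 3 → ℤ) :=
  Fintype.piFinset fun _ => Finset.Icc (-(blockDegree q : ℤ)) (blockDegree q)

theorem abs_le_of_mem_blockFreqs {q : ℤ} {n : Fin 3 → ℤ} (hn : n ∈ blockFreqs q) (i : Fin 3) :
    |n i| ≤ (blockDegree q : ℤ) := by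
  rw [blockFreqs, Fintype.mem_piFinset] at hn
  exact abs_le.mpr (Finset.mem_Icc.mp (hn i))

theorem blockDegree_eq {q : ℤ} (hq : -1 ≤ q) : (blockDegree q : ℝ) = 2 * 2 ^ q := by
  have h : ((q + 1).toNat : ℤ) = q + 1 := Int.toNat_of_nonneg (by omega)
  rw [blockDegree, Nat.cast_pow, Nat.cast_ofNat, ← zpow_natCast, h, zpow_add₀ two_ne_zero, zpow_one,
    mul_comm]

/-- A coordinate beyond `2^(q+1)` gives `|Lξ/2^q| ≥ 2` for `q ≥ 0`, so both cutoffs vanish,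
including the one dilated by `1/2`. For `q = -1` it gives `|Lξ| ≥ 1`. -/
theorem symbol_eq_zero {χ : E3 → ℝ} (hχ : IsCutoff χ) {L : ℝ} (hL : 0 < L) {q : ℤ}
    {n : Fin 3 → ℤ} (hn : n ∉ blockFreqs q) : symbol χ L q (freq L n) = 0 := by
  have hn' : ∃ i, (blockDegree q : ℝ) < |(n i : ℝ)| := by
    by_contra! h
    refine hn (Fintype.mem_piFinset.mpr fun i => Finset.mem_Icc.mpr (abs_le.mp ?_))
    have := h i
    rw [← Int.cast_abs] at this
    exact_mod_cast this
  obtain ⟨i, hi⟩ := hn'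
  have h1 : (blockDegree q : ℝ) / L ≤ ‖freq L n‖ := by
    refine le_trans ?_ (PiLp.norm_apply_le (freq L n) i)
    rw [freq, Real.norm_eq_abs, abs_div, abs_of_pos hL]
    gcongr
  have h2 : (1 : ℝ) ≤ blockDegree q := by exact_mod_cast Nat.one_le_two_pow
  rw [symbol]
  split_ifs with hq hq
  · refine hχ.eq_zero ?_
    rw [norm_smul, Real.norm_eq_abs, abs_of_pos hL]
    calc (1 : ℝ) ≤ L * (blockDegree q / L) := by field_simp; exact h2
      _ ≤ _ := by gcongr
  · have h3 : (2 : ℝ) ≤ ‖(L / 2 ^ q) • freq L n‖ := by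
      rw [norm_smul, Real.norm_eq_abs, abs_of_pos (div_pos hL (by positivity))]
      calc (2 : ℝ) = L / 2 ^ q * (blockDegree q / L) := by
            rw [blockDegree_eq (by omega)]; field_simp
        _ ≤ _ := by gcongr
    have h4 : (1 : ℝ) ≤ ‖(1 / 2 : ℝ) • (L / 2 ^ q) • freq L n‖ := by
      rw [norm_smul, Real.norm_eq_abs, abs_of_pos (by norm_num)]
      linarith
    have h5 : (1 : ℝ) ≤ ‖(L / 2 ^ q) • freq L n‖ := by linarith
    rw [hχ.eq_zero h4, hχ.eq_zero h5, sub_zero]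
  · rfl

/-- The cosine coefficients of a block. -/
def blockRe (χ : E3 → ℝ) (L : ℝ) (q : ℤ) (g : E3 → E3) (n : Fin 3 → ℤ) : E3 :=
  WithLp.toLp 2 fun i =>
    symbol χ L q (freq L n) * (boxFourierCoeff L (fun y => g y i) (freq L n)).re

/-- The sine coefficients of a block. -/
def blockIm (χ : E3 → ℝ) (L : ℝ) (q : ℤ) (g : E3 → E3) (n : Fin 3 → ℤ) : E3 :=
  WithLp.toLp 2 fun i =>
    symbol χ L q (freq L n) * (boxFourierCoeff L (fun y => g y i) (freq L n)).im

/-- The real part of `c e^{iφ}` is `Re c cos φ - Im c sin φ`, and the symbol cuts the series down to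
a finite sum. -/
theorem block_eq_trigField {χ : E3 → ℝ} (hχ : IsCutoff χ) {L : ℝ} (hL : 0 < L) (q : ℤ)
    (g : E3 → E3) :
    block χ L q g = trigField L (blockFreqs q) (blockRe χ L q g) (blockIm χ L q g) := by
  funext x
  ext i
  rw [block, trigField, PiLp.toLp_apply]
  rw [tsum_eq_sum (s := blockFreqs q) fun n hn => by simp [symbol_eq_zero hχ hL hn]]
  rw [Complex.re_sum, WithLp.ofLp_sum, Finset.sum_apply]
  refine Finset.sum_congr rfl fun n _ => ?_
  rw [character_freq, Complex.mul_re, Complex.exp_ofReal_mul_I_re, Complex.exp_ofReal_mul_I_im,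
    Complex.re_ofReal_mul, Complex.im_ofReal_mul]
  simp only [PiLp.sub_apply, PiLp.smul_apply, blockRe, blockIm, smul_eq_mul]
  ring

theorem contDiff_block {χ : E3 → ℝ} (hχ : IsCutoff χ) {L : ℝ} (hL : 0 < L) (q : ℤ)
    (g : E3 → E3) : ContDiff ℝ ∞ (block χ L q g) := by
  rw [block_eq_trigField hχ hL]
  exact contDiff_trigField _ _ _ _

theorem periodic_block {χ : E3 → ℝ} (hχ : IsCutoff χ) {L : ℝ} (hL : 0 < L) (q : ℤ)
    (g : E3 → E3) : Periodic L (block χ L q g) := by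
  rw [block_eq_trigField hχ hL]
  exact periodic_trigField hL _ _ _

/-- The derivatives of a block are combinations of translates of the block. -/
theorem exists_pderiv_block {χ : E3 → ℝ} (hχ : IsCutoff χ) {L : ℝ} (hL : 0 < L) {q : ℤ}
    (hq : -1 ≤ q) : ∃ (M : ℕ) (c τ : ℕ → ℝ),
      ∑ j ∈ Finset.range M, |c j| ≤ 8 * Real.pi / L * 2 ^ q ∧
      ∀ (g : E3 → E3) (i : Fin 3) (x : E3), pderiv i (block χ L q g) x
        = ∑ j ∈ Finset.range M, c j • block χ L q g (x + τ j • e i) := by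
  obtain ⟨M, c, τ, hc, h⟩ := exists_pderiv_eq_sum_translates hL (blockDegree q)
    (Nat.two_pow_pos _)
  refine ⟨M, c, τ, hc.trans_eq ?_, fun g i x => ?_⟩
  · rw [blockDegree_eq hq]; ring
  · rw [block_eq_trigField hχ hL]
    exact h _ (fun n hn i => abs_le_of_mem_blockFreqs hn i) _ _ i x

/-! ### Continuity in time -/

theorem memLp_smul_e {L : ℝ} {w : E3 → ℝ} (hw : Continuous w) (hb : ∀ x, |w x| ≤ 1) (i : Fin 3) :
    MemLp (fun x => w x • e i) 2 (volume.restrict (box L)) := by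
  have : IsFiniteMeasure ((volume : Measure E3).restrict (box L)) :=
    ⟨by simpa using volume_box_lt_top L⟩
  refine MemLp.of_bound (C := 1) (by fun_prop) (ae_of_all _ fun x => ?_)
  have h1 : ‖e i‖ = 1 := by simp [e]
  rw [norm_smul, Real.norm_eq_abs, h1, mul_one]
  exact hb x

/-- Expresses the coefficient through pairings with two fixed `L²` fields, to which weak continuity
in time applies. -/
theorem boxFourierCoeff_eq {L : ℝ} {g : E3 → E3} (hg : MemLp g 2 (volume.restrict (box L)))
    (n : Fin 3 → ℤ) (i : Fin 3) : boxFourierCoeff L (fun y => g y i) (freq L n) =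
      ((L ^ 3)⁻¹ : ℝ) * (((∫ x in box L, inner ℝ (g x) (Real.cos (phase L n x) • e i) : ℝ) : ℂ)
        - ((∫ x in box L, inner ℝ (g x) (Real.sin (phase L n x) • e i) : ℝ) : ℂ) * Complex.I) := by
  have hfin : IsFiniteMeasure ((volume : Measure E3).restrict (box L)) :=
    ⟨by simpa using volume_box_lt_top L⟩
  have hin : ∀ (x : E3) (w : ℝ), inner ℝ (g x) (w • e i) = g x i * w := fun x w => by
    rw [inner_smul_right, e, EuclideanSpace.inner_single_right]
    simp
    ring
  have hgi : Integrable (fun x => g x i) (volume.restrict (box L)) := by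
    have h1 : Integrable g (volume.restrict (box L)) := hg.integrable (by norm_num)
    exact (EuclideanSpace.proj i : E3 →L[ℝ] ℝ).integrable_comp h1
  have hcos : Integrable (fun x => g x i * Real.cos (phase L n x)) (volume.restrict (box L)) := by
    refine hgi.mul_bdd (c := 1) (by fun_prop) (ae_of_all _ fun x => ?_)
    exact Real.abs_cos_le_one _
  have hsin : Integrable (fun x => g x i * Real.sin (phase L n x)) (volume.restrict (box L)) := by
    refine hgi.mul_bdd (c := 1) (by fun_prop) (ae_of_all _ fun x => ?_)
    exact Real.abs_sin_le_one _
  rw [boxFourierCoeff]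
  congr 1
  simp only [hin]
  rw [← integral_complex_ofReal, ← integral_complex_ofReal, ← integral_mul_const,
    ← integral_sub hcos.ofReal (hsin.ofReal.mul_const _)]
  refine integral_congr_ae (ae_of_all _ fun x => ?_)
  simp only [character_neg_freq, Complex.exp_mul_I, ← Complex.ofReal_cos, ← Complex.ofReal_sin,
    Real.cos_neg, Real.sin_neg]
  push_cast
  ring

theorem continuousOn_boxFourierCoeff {L T : ℝ} {u : ℝ → E3 → E3} (hu : WeaklyContinuous L T u)
    (n : Fin 3 → ℤ) (i : Fin 3) :
    ContinuousOn (fun t => boxFourierCoeff L (fun y => u t y i) (freq L n)) (Icc 0 T) := by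
  have h1 := hu.continuousOn (fun x => Real.cos (phase L n x) • e i)
    (memLp_smul_e (by fun_prop) (fun _ => Real.abs_cos_le_one _) i)
  have h2 := hu.continuousOn (fun x => Real.sin (phase L n x) • e i)
    (memLp_smul_e (by fun_prop) (fun _ => Real.abs_sin_le_one _) i)
  refine ContinuousOn.congr ?_ fun t ht => boxFourierCoeff_eq (hu.memLp t ht) n i
  exact continuousOn_const.mul ((Complex.continuous_ofReal.comp_continuousOn h1).sub
    ((Complex.continuous_ofReal.comp_continuousOn h2).mul continuousOn_const))

theorem continuousOn_blockRe {χ : E3 → ℝ} {L T : ℝ} {u : ℝ → E3 → E3}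
    (hu : WeaklyContinuous L T u) (q : ℤ) (n : Fin 3 → ℤ) :
    ContinuousOn (fun t => blockRe χ L q (u t) n) (Icc 0 T) := by
  refine (PiLp.continuous_toLp 2 _).comp_continuousOn (continuousOn_pi.mpr fun i => ?_)
  exact continuousOn_const.mul
    (Complex.continuous_re.comp_continuousOn (continuousOn_boxFourierCoeff hu n i))

theorem continuousOn_blockIm {χ : E3 → ℝ} {L T : ℝ} {u : ℝ → E3 → E3}
    (hu : WeaklyContinuous L T u) (q : ℤ) (n : Fin 3 → ℤ) :
    ContinuousOn (fun t => blockIm χ L q (u t) n) (Icc 0 T) := by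
  refine (PiLp.continuous_toLp 2 _).comp_continuousOn (continuousOn_pi.mpr fun i => ?_)
  exact continuousOn_const.mul
    (Complex.continuous_im.comp_continuousOn (continuousOn_boxFourierCoeff hu n i))

/-- The blocks are continuous in space and time. -/
theorem continuousOn_block {χ : E3 → ℝ} (hχ : IsCutoff χ) {L T : ℝ} (hL : 0 < L)
    {u : ℝ → E3 → E3} (hu : WeaklyContinuous L T u) (q : ℤ) :
    ContinuousOn (fun z : ℝ × E3 => block χ L q (u z.1) z.2) (slab T) := by
  simp only [block_eq_trigField hχ hL, trigField]
  refine continuousOn_finsetSum _ fun n _ => ?_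
  have h1 : ContinuousOn (fun z : ℝ × E3 => blockRe χ L q (u z.1) n) (slab T) :=
    (continuousOn_blockRe hu q n).comp continuousOn_fst fun z hz => hz.1
  have h2 : ContinuousOn (fun z : ℝ × E3 => blockIm χ L q (u z.1) n) (slab T) :=
    (continuousOn_blockIm hu q n).comp continuousOn_fst fun z hz => hz.1
  have h3 : Continuous fun z : ℝ × E3 => Real.cos (phase L n z.2) := by fun_prop
  have h4 : Continuous fun z : ℝ × E3 => Real.sin (phase L n z.2) := by fun_prop
  exact (h3.continuousOn.smul h1).sub (h4.continuousOn.smul h2)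

theorem continuousOn_pderiv_block {χ : E3 → ℝ} (hχ : IsCutoff χ) {L T : ℝ} (hL : 0 < L)
    {u : ℝ → E3 → E3} (hu : WeaklyContinuous L T u) {q : ℤ} (hq : -1 ≤ q) (i : Fin 3) :
    ContinuousOn (fun z : ℝ × E3 => pderiv i (block χ L q (u z.1)) z.2) (slab T) := by
  obtain ⟨M, c, τ, -, h⟩ := exists_pderiv_block hχ hL hq
  simp only [h]
  refine continuousOn_finsetSum _ fun j _ => ?_
  exact (continuousOn_translate (continuousOn_block hχ hL hu q) (τ j • e i)).const_smul (c j)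

/-- Bernstein's inequality for the blocks in the space-time `L³` norm. -/
theorem eLpNorm_pderiv_block_le {χ : E3 → ℝ} (hχ : IsCutoff χ) {L T : ℝ} (hL : 0 < L)
    {u : ℝ → E3 → E3} (hu : WeaklyContinuous L T u) {q : ℤ} (hq : -1 ≤ q) (i : Fin 3) :
    eLpNorm (fun z : ℝ × E3 => pderiv i (block χ L q (u z.1)) z.2) 3
        (volume.restrict (cylinder L T))
      ≤ ENNReal.ofReal (8 * Real.pi / L * 2 ^ q) *
        eLpNorm (fun z : ℝ × E3 => block χ L q (u z.1) z.2) 3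
          (volume.restrict (cylinder L T)) := by
  obtain ⟨M, c, τ, hc, h⟩ := exists_pderiv_block hχ hL hq
  have hb := continuousOn_block hχ hL hu q
  have hfun : (fun z : ℝ × E3 => pderiv i (block χ L q (u z.1)) z.2) =
      ∑ j ∈ Finset.range M,
        c j • fun z : ℝ × E3 => block χ L q (u z.1) (z.2 + τ j • e i) := by
    funext z
    rw [h, Finset.sum_apply]
    rfl
  rw [hfun]
  -- Minkowski's inequality; every translate has the same norm, so only the total weight of the
  -- quadrature remains.
  refine (eLpNorm_sum_le (fun j _ => (aestronglyMeasurable_of_slab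
    (continuousOn_translate hb (τ j • e i))).const_smul (c j)) (by norm_num)).trans ?_
  have hj : ∀ j, eLpNorm (c j • fun z : ℝ × E3 => block χ L q (u z.1) (z.2 + τ j • e i)) 3
      (volume.restrict (cylinder L T)) = ENNReal.ofReal |c j| *
        eLpNorm (fun z : ℝ × E3 => block χ L q (u z.1) z.2) 3
          (volume.restrict (cylinder L T)) := fun j => by
    rw [eLpNorm_const_smul, eLpNorm_cylinder_translate hL hb
      (fun t _ => periodic_block hχ hL q (u t)) (τ j • e i), Real.enorm_eq_ofReal_abs]
  simp only [hj]
  rw [← Finset.sum_mul, ← ENNReal.ofReal_sum_of_nonneg fun j _ => abs_nonneg _]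
  gcongr

/-! ### Dyadic cubes -/

theorem waveNumber_pos {L : ℝ} (hL : 0 < L) (q : ℕ) : 0 < waveNumber L q := by
  unfold waveNumber
  positivity

/-- The multi-index of the dyadic cube of generation `q` of the whole space containing `x`. -/
def cell (L : ℝ) (q : ℕ) (x : E3) (i : Fin 3) : ℤ := ⌊waveNumber L q * x i⌋

theorem measurable_cell (L : ℝ) (q : ℕ) : Measurable (cell L q) := by
  refine measurable_pi_lambda _ fun i => Int.measurable_floor.comp ?_
  fun_prop

/-- Reduces the geometry of cubes on the torus to integers: translation by a period shifts the cell
index by `2^q`. -/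
theorem mem_dyadicCube_iff {L : ℝ} (hL : 0 < L) {q : ℕ} {k : Fin 3 → ℤ} {x : E3} :
    x ∈ dyadicCube L q k ↔ ∃ m : Fin 3 → ℤ, ∀ i, cell L q x i = k i + 2 ^ q * m i := by
  refine exists_congr fun m => forall_congr' fun i => ?_
  rw [cell, Int.floor_eq_iff, mem_Ico]
  push_cast
  have h : waveNumber L q * x i = 2 ^ q * m i + (x i - L * m i) / (L / 2 ^ q) := by
    rw [waveNumber]
    field_simp
    ring
  have h0 : 0 < L / 2 ^ q := by positivity
  have h1 : L / 2 ^ q * k i ≤ x i - L * m i ↔ k i ≤ (x i - L * m i) / (L / 2 ^ q) := by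
    rw [le_div_iff₀ h0, mul_comm]
  have h2 : x i - L * m i < L / 2 ^ q * (k i + 1) ↔ (x i - L * m i) / (L / 2 ^ q) < k i + 1 := by
    rw [div_lt_iff₀ h0, mul_comm (L / 2 ^ q)]
  rw [h1, h2, h]
  constructor <;> rintro ⟨a, b⟩ <;> constructor <;> linarith

theorem mem_dilatedCube_iff {L : ℝ} (hL : 0 < L) {q : ℕ} {k : Fin 3 → ℤ} {x : E3} :
    x ∈ dilatedCube L q k ↔ ∃ d m : Fin 3 → ℤ, ∑ i, d i ^ 2 < 9 ∧
      ∀ i, cell L q x i = k i + d i + 2 ^ q * m i := by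
  simp only [dilatedCube, mem_iUnion, mem_ofPred_eq, mem_dyadicCube_iff hL, exists_prop]
  constructor
  · rintro ⟨k', hk', m, hm⟩
    exact ⟨fun i => k' i - k i, m, hk', fun i => by rw [hm i]; ring⟩
  · rintro ⟨d, m, hd, hm⟩
    exact ⟨fun i => k i + d i, by simpa using hd, m, hm⟩

theorem measurableSet_dyadicCube {L : ℝ} (hL : 0 < L) (q : ℕ) (k : Fin 3 → ℤ) :
    MeasurableSet (dyadicCube L q k) := by
  have : dyadicCube L q k = cell L q ⁻¹' {c | ∃ m : Fin 3 → ℤ, ∀ i, c i = k i + 2 ^ q * m i} := by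
    ext x
    exact mem_dyadicCube_iff hL
  rw [this]
  exact measurable_cell L q (to_countable _).measurableSet

theorem cell_add_period {L : ℝ} (hL : 0 < L) (q : ℕ) (x : E3) (j i : Fin 3) :
    cell L q (x + L • e j) i = cell L q x i + 2 ^ q * (if i = j then 1 else 0) := by
  have h : waveNumber L q * (x + L • e j) i
      = waveNumber L q * x i + ((2 ^ q * (if i = j then 1 else 0) : ℤ) : ℝ) := by
    simp only [PiLp.add_apply, PiLp.smul_apply, e, PiLp.single_apply, smul_eq_mul, waveNumber]
    split_ifs <;> push_cast <;> field_simp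
  rw [cell, h, Int.floor_add_intCast, cell]

theorem periodic_dyadicCube {L : ℝ} (hL : 0 < L) (q : ℕ) (k : Fin 3 → ℤ) :
    Periodic L (fun x => x ∈ dyadicCube L q k) := by
  intro x j
  simp only [mem_dyadicCube_iff hL, cell_add_period hL, eq_iff_iff]
  constructor
  · rintro ⟨m, hm⟩
    exact ⟨fun i => m i - if i = j then 1 else 0, fun i => by linarith [hm i]⟩
  · rintro ⟨m, hm⟩
    exact ⟨fun i => m i + if i = j then 1 else 0, fun i => by linarith [hm i]⟩

theorem periodic_openDilatedCube {L : ℝ} (hL : 0 < L) (q : ℕ) (k : Fin 3 → ℤ) :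
    Periodic L (fun x => x ∈ openDilatedCube L q k) := by
  intro x j
  have h1 : (Homeomorph.addRight (L • e j)) ⁻¹' dilatedCube L q k = dilatedCube L q k := by
    ext y
    simp only [dilatedCube, mem_preimage, mem_iUnion, Homeomorph.coe_addRight]
    exact exists_congr fun k' => exists_congr fun _ => (periodic_dyadicCube hL q k' y j).to_iff
  have h2 := (Homeomorph.addRight (L • e j)).preimage_interior (dilatedCube L q k)
  rw [h1] at h2
  rw [openDilatedCube]
  conv_rhs => rw [← h2]
  rfl

theorem cell_near {L : ℝ} {q : ℕ} {x y : E3} (h : ‖waveNumber L q • (x - y)‖ < 1) (i : Fin 3) :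
    |cell L q x i - cell L q y i| ≤ 1 := by
  have h1 : |waveNumber L q * x i - waveNumber L q * y i| < 1 := by
    refine lt_of_le_of_lt ?_ h
    have := PiLp.norm_apply_le (waveNumber L q • (x - y)) i
    simpa [mul_sub] using this
  rw [abs_lt] at h1
  rw [cell, cell, abs_le]
  have a1 := Int.floor_le (waveNumber L q * x i)
  have a2 := Int.lt_floor_add_one (waveNumber L q * x i)
  have b1 := Int.floor_le (waveNumber L q * y i)
  have b2 := Int.lt_floor_add_one (waveNumber L q * y i)
  constructor
  · have : (⌊waveNumber L q * y i⌋ : ℝ) < ⌊waveNumber L q * x i⌋ + 2 := by linarith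
    have : ⌊waveNumber L q * y i⌋ < ⌊waveNumber L q * x i⌋ + 2 := by exact_mod_cast this
    omega
  · have : (⌊waveNumber L q * x i⌋ : ℝ) < ⌊waveNumber L q * y i⌋ + 2 := by linarith
    have : ⌊waveNumber L q * x i⌋ < ⌊waveNumber L q * y i⌋ + 2 := by exact_mod_cast this
    omega

theorem exists_cell_eq_of_near {L : ℝ} (hL : 0 < L) {q : ℕ} {k : Fin 3 → ℤ} {x y : E3}
    (hy : y ∈ dyadicCube L q k) (h : ‖waveNumber L q • (x - y)‖ < 1) :
    ∃ d m : Fin 3 → ℤ, (∀ i, |d i| ≤ 1) ∧ ∀ i, cell L q x i = k i + d i + 2 ^ q * m i := by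
  obtain ⟨m, hm⟩ := (mem_dyadicCube_iff hL).mp hy
  exact ⟨fun i => cell L q x i - cell L q y i, m, cell_near h, fun i => by linarith [hm i]⟩

/-- The open ball of radius `ℓ_q` about `y` meets only neighbouring cells, whose offsets satisfy
`|d|² ≤ 3 < 9`, so it lies inside the dilated cube and makes `x` an interior point. -/
theorem mem_openDilatedCube_of_near {L : ℝ} (hL : 0 < L) {q : ℕ} {k : Fin 3 → ℤ} {x y : E3}
    (hy : y ∈ dyadicCube L q k) (h : ‖waveNumber L q • (x - y)‖ < 1) :
    x ∈ openDilatedCube L q k := by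
  refine mem_interior.mpr ⟨{x' | ‖waveNumber L q • (x' - y)‖ < 1}, fun x' hx' => ?_,
    isOpen_lt (by fun_prop) continuous_const, h⟩
  obtain ⟨d, m, hd, hm⟩ := exists_cell_eq_of_near hL hy hx'
  refine (mem_dilatedCube_iff hL).mpr ⟨d, m, ?_, hm⟩
  have h1 : ∀ i, d i ^ 2 ≤ 1 := fun i => (sq_le_one_iff_abs_le_one _).mpr (hd i)
  rw [Fin.sum_univ_three]
  linarith [h1 0, h1 1, h1 2]

/-- The faces of the dyadic cubes of generation `q`. -/
def dyadicFaces (L : ℝ) (q : ℕ) : Set E3 :=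
  {x | ∃ (i : Fin 3) (m : ℤ), x i = m / waveNumber L q}

/-- Membership depends only on the cell index, which is constant on the open cell around a point off
the faces. -/
theorem dilatedCube_subset {L : ℝ} (hL : 0 < L) (q : ℕ) (k : Fin 3 → ℤ) :
    dilatedCube L q k ⊆ openDilatedCube L q k ∪ dyadicFaces L q := by
  intro x hx
  by_cases hf : x ∈ dyadicFaces L q
  · exact Or.inr hf
  left
  have hpos := waveNumber_pos hL q
  refine mem_interior.mpr ⟨⋂ i, {x' : E3 | (cell L q x i : ℝ) < waveNumber L q * x' i} ∩
    {x' | waveNumber L q * x' i < cell L q x i + 1}, fun x' hx' => ?_, ?_, ?_⟩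
  · have : cell L q x' = cell L q x := by
      funext i
      have := mem_iInter.mp hx' i
      exact Int.floor_eq_iff.mpr ⟨this.1.le, this.2⟩
    rw [mem_dilatedCube_iff hL] at hx ⊢
    rwa [this]
  · refine isOpen_iInter_of_finite fun i => (isOpen_lt continuous_const ?_).inter
      (isOpen_lt ?_ continuous_const) <;> fun_prop
  · refine mem_iInter.mpr fun i => ⟨lt_of_le_of_ne (Int.floor_le (waveNumber L q * x i))
      fun h => hf ⟨i, cell L q x i, ?_⟩, Int.lt_floor_add_one (waveNumber L q * x i)⟩
    rw [eq_div_iff hpos.ne', mul_comm]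
    exact h.symm

theorem volume_dyadicFaces (L : ℝ) (q : ℕ) : volume (dyadicFaces L q) = 0 := by
  have : dyadicFaces L q = ⋃ (i : Fin 3) (m : ℤ),
      (WithLp.ofLp : E3 → (Fin 3 → ℝ)) ⁻¹' {f | f i = m / waveNumber L q} := by
    ext x
    simp [dyadicFaces]
  rw [this]
  refine measure_iUnion_null fun i => measure_iUnion_null fun m => ?_
  refine (PiLp.volume_preserving_ofLp (Fin 3)).quasiMeasurePreserving.preimage_null ?_
  exact Measure.pi_hyperplane _ i _

/-! ### The mollified characteristic functions -/

/-- The rescaled mollifier. -/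
def scaledMollifier (η : E3 → ℝ) (L : ℝ) (q : ℕ) (x : E3) : ℝ :=
  2 ^ (3 * q) * η (waveNumber L q • x)

theorem hasCompactSupport_scaledMollifier {η : E3 → ℝ} (hη : IsMollifier η) {L : ℝ} (hL : 0 < L)
    (q : ℕ) : HasCompactSupport (scaledMollifier η L q) := by
  have h : HasCompactSupport η := HasCompactSupport.of_support_subset_isCompact
    (isCompact_closedBall (0 : E3) 1) (hη.supp.trans Metric.ball_subset_closedBall)
  exact (h.comp_smul (waveNumber_pos hL q).ne').mul_left

theorem contDiff_scaledMollifier {η : E3 → ℝ} (hη : IsMollifier η) (L : ℝ) (q : ℕ) :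
    ContDiff ℝ ∞ (scaledMollifier η L q) :=
  contDiff_const.mul (hη.smooth.comp (contDiff_const_smul _))

/-- Since `2^{3q} λ_q^{-3} = L³`, the mass is one for the normalized measure `L^{-3} dx`. -/
theorem integral_scaledMollifier {η : E3 → ℝ} (hη : IsMollifier η) {L : ℝ} (hL : 0 < L) (q : ℕ) :
    ∫ x, scaledMollifier η L q x = L ^ 3 := by
  simp only [scaledMollifier]
  rw [integral_const_mul, Measure.integral_comp_smul, hη.integral_eq_one, finrank_euclideanSpace,
    Fintype.card_fin, abs_of_pos (inv_pos.mpr (pow_pos (waveNumber_pos hL q) 3)), waveNumber,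
    pow_mul', smul_eq_mul]
  field_simp

theorem contDiff_smoothCube {η : E3 → ℝ} (hη : IsMollifier η) {L : ℝ} (hL : 0 < L) (q : ℕ)
    (k : Fin 3 → ℤ) : ContDiff ℝ ∞ (smoothCube η L q k) := by
  have h := (hasCompactSupport_scaledMollifier hη hL q).contDiff_convolution_right
    (ContinuousLinearMap.mul ℝ ℝ)
    ((locallyIntegrable_const (1 : ℝ)).indicator (measurableSet_dyadicCube hL q k))
    (contDiff_scaledMollifier hη L q) (μ := volume)
  exact contDiff_const.mul h

theorem periodic_smoothCube (η : E3 → ℝ) {L : ℝ} (hL : 0 < L) (q : ℕ) (k : Fin 3 → ℤ) :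
    Periodic L (smoothCube η L q k) := by
  intro x i
  rw [smoothCube, smoothCube, ← integral_add_right_eq_self _ (L • e i)]
  congr 2
  funext y
  have h1 : (dyadicCube L q k).indicator (fun _ => (1 : ℝ)) (y + L • e i)
      = (dyadicCube L q k).indicator (fun _ => (1 : ℝ)) y := by
    classical
    simp only [indicator_apply]
    exact if_congr (periodic_dyadicCube hL q k y i).to_iff rfl rfl
  rw [h1, add_sub_add_right_eq_sub]

/-- The indices of the dyadic cubes of generation `q` of the torus. -/
def cubeIndices (q : ℕ) : Finset (Fin 3 → ℤ) := Fintype.piFinset fun _ => Finset.Ico 0 (2 ^ q)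

theorem mem_cubeIndices {q : ℕ} {k : Fin 3 → ℤ} :
    k ∈ cubeIndices q ↔ ∀ i, 0 ≤ k i ∧ k i ≤ 2 ^ q - 1 := by
  simp only [cubeIndices, Fintype.mem_piFinset, Finset.mem_Ico, Int.le_sub_one_iff]

theorem eq_emod_of_mem_cubeIndices {q : ℕ} {k : Fin 3 → ℤ} (hk : k ∈ cubeIndices q) {a m : ℤ}
    {i : Fin 3} (h : a = k i + 2 ^ q * m) : k i = a % 2 ^ q := by
  have := mem_cubeIndices.mp hk i
  rw [h, Int.add_mul_emod_self_left, Int.emod_eq_of_lt this.1 (by omega)]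

theorem sum_indicator_dyadicCube {L : ℝ} (hL : 0 < L) (q : ℕ) (x : E3) :
    ∑ k ∈ cubeIndices q, (dyadicCube L q k).indicator (fun _ => (1 : ℝ)) x = 1 := by
  have h2 : (0 : ℤ) < 2 ^ q := by positivity
  rw [Finset.sum_eq_single (fun i => cell L q x i % 2 ^ q)]
  · refine indicator_of_mem ((mem_dyadicCube_iff hL).mpr ⟨fun i => cell L q x i / 2 ^ q, fun i => ?_⟩) _
    exact (Int.emod_add_mul_ediv _ _).symm
  · intro k hk hne
    refine indicator_of_notMem (fun hx => hne ?_) _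
    obtain ⟨m, hm⟩ := (mem_dyadicCube_iff hL).mp hx
    exact funext fun i => eq_emod_of_mem_cubeIndices hk (hm i)
  · intro h
    refine absurd (mem_cubeIndices.mpr fun i => ⟨Int.emod_nonneg _ h2.ne', ?_⟩) h
    have := Int.emod_lt_of_pos (cell L q x i) h2
    omega

/-- Partition of unity: the cubes tile the torus, and convolution with a kernel of normalized mass
one preserves the constant 1. -/
theorem sum_smoothCube {η : E3 → ℝ} (hη : IsMollifier η) {L : ℝ} (hL : 0 < L) (q : ℕ) (x : E3) :
    ∑ k ∈ cubeIndices q, smoothCube η L q k x = 1 := by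
  have hint : Integrable (fun y => scaledMollifier η L q (x - y)) :=
    ((contDiff_scaledMollifier hη L q).continuous.integrable_of_hasCompactSupport
      (hasCompactSupport_scaledMollifier hη hL q)).comp_sub_left x
  have hint' : ∀ k ∈ cubeIndices q, Integrable (fun y =>
      (dyadicCube L q k).indicator (fun _ => (1 : ℝ)) y * scaledMollifier η L q (x - y)) := by
    intro k _
    have : (fun y => (dyadicCube L q k).indicator (fun _ => (1 : ℝ)) y *
        scaledMollifier η L q (x - y)) =
        (dyadicCube L q k).indicator fun y => scaledMollifier η L q (x - y) := by
      classical
      funext y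
      simp [indicator_apply]
    rw [this]
    exact hint.indicator (measurableSet_dyadicCube hL q k)
  change ∑ k ∈ cubeIndices q, (L ^ 3)⁻¹ * ∫ y,
    (dyadicCube L q k).indicator (fun _ => (1 : ℝ)) y * scaledMollifier η L q (x - y) = 1
  rw [← Finset.mul_sum, ← integral_finsetSum _ hint']
  simp only [← Finset.sum_mul, sum_indicator_dyadicCube hL, one_mul]
  rw [integral_sub_left_eq_self (scaledMollifier η L q), integral_scaledMollifier hη hL]
  field_simp

theorem exists_near_of_smoothCube_ne_zero {η : E3 → ℝ} (hη : IsMollifier η) {L : ℝ} {q : ℕ}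
    {k : Fin 3 → ℤ} {x : E3} (h : smoothCube η L q k x ≠ 0) :
    ∃ y ∈ dyadicCube L q k, ‖waveNumber L q • (x - y)‖ < 1 := by
  classical
  by_contra! hc
  refine h ?_
  have : ∀ y, (dyadicCube L q k).indicator (fun _ => (1 : ℝ)) y *
      (2 ^ (3 * q) * η (waveNumber L q • (x - y))) = 0 := by
    intro y
    by_cases hy : y ∈ dyadicCube L q k
    · have h1 : η (waveNumber L q • (x - y)) = 0 := by
        by_contra h0
        have := hη.supp h0
        rw [mem_ball_zero_iff] at this
        linarith [hc y hy]
      rw [h1, mul_zero, mul_zero]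
    · rw [indicator_of_notMem hy, zero_mul]
  simp only [smoothCube, this, integral_zero, mul_zero]

/-- Such a `k` is, modulo `2^q`, the cell of `x` minus an offset in `{-1, 0, 1}³`, which leaves 27
choices. -/
theorem card_smoothCube_ne_zero_le {η : E3 → ℝ} (hη : IsMollifier η) {L : ℝ} (hL : 0 < L) (q : ℕ)
    (x : E3) : ((cubeIndices q).filter fun k => smoothCube η L q k x ≠ 0).card ≤ 27 := by
  classical
  have hsub : ((cubeIndices q).filter fun k => smoothCube η L q k x ≠ 0) ⊆
      (Fintype.piFinset fun _ : Fin 3 => Finset.Icc (-1 : ℤ) 1).image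
        (fun d i => (cell L q x i - d i) % 2 ^ q) := by
    intro k hk
    rw [Finset.mem_filter] at hk
    obtain ⟨y, hy, hxy⟩ := exists_near_of_smoothCube_ne_zero hη hk.2
    obtain ⟨d, m, hd, hm⟩ := exists_cell_eq_of_near hL hy hxy
    refine Finset.mem_image.mpr ⟨d, Fintype.mem_piFinset.mpr fun i =>
      Finset.mem_Icc.mpr (abs_le.mp (hd i)), funext fun i => ?_⟩
    exact (eq_emod_of_mem_cubeIndices hk.1 (m := m i) (by linarith [hm i])).symm
  refine (Finset.card_le_card hsub).trans (Finset.card_image_le.trans ?_)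
  simp

/-! ### Mixed derivatives -/

theorem contDiff_pderiv {g : E3 → E3} (hg : ContDiff ℝ ∞ g) (i : Fin 3) :
    ContDiff ℝ ∞ (pderiv i g) :=
  (hg.fderiv_right (m := ∞) (by simp)).clm_apply contDiff_const

theorem periodic_pderiv {L : ℝ} {g : E3 → E3} (hg : Periodic L g) (i : Fin 3) :
    Periodic L (pderiv i g) := by
  intro x j
  have : (fun y => g (y + L • e j)) = g := funext fun y => hg y j
  rw [pderiv, pderiv, ← fderiv_comp_add_right, this]

theorem pderiv_sum {ι : Type} (S : Finset ι) (a : ι → ℝ) {w : ι → E3 → E3}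
    (hw : ∀ n, ContDiff ℝ ∞ (w n)) (i : Fin 3) :
    pderiv i (fun x => ∑ n ∈ S, a n • w n x) = fun x => ∑ n ∈ S, a n • pderiv i (w n) x := by
  funext x
  have hd : ∀ n, DifferentiableAt ℝ (w n) x := fun n =>
    (hw n).differentiable (by simp) x
  have hs : ∀ n ∈ S, DifferentiableAt ℝ (fun x => a n • w n x) x := fun n _ =>
    (hd n).const_smul (a n)
  rw [pderiv, fderiv_fun_sum hs, sum_apply]
  refine Finset.sum_congr rfl fun n _ => ?_
  rw [fderiv_fun_const_smul (hd n), smul_apply, pderiv]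

theorem contDiff_iterate_pderiv {g : E3 → E3} (hg : ContDiff ℝ ∞ g) (i : Fin 3) (k : ℕ) :
    ContDiff ℝ ∞ ((pderiv i)^[k] g) := by
  induction k with
  | zero => exact hg
  | succ k ih =>
    rw [Function.iterate_succ_apply']
    exact contDiff_pderiv ih i

theorem periodic_iterate_pderiv {L : ℝ} {g : E3 → E3} (hg : Periodic L g) (i : Fin 3) (k : ℕ) :
    Periodic L ((pderiv i)^[k] g) := by
  induction k with
  | zero => exact hg
  | succ k ih =>
    rw [Function.iterate_succ_apply']
    exact periodic_pderiv ih i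

theorem iterate_pderiv_sum {ι : Type} (S : Finset ι) (a : ι → ℝ) {w : ι → E3 → E3}
    (hw : ∀ n, ContDiff ℝ ∞ (w n)) (i : Fin 3) (k : ℕ) :
    (pderiv i)^[k] (fun x => ∑ n ∈ S, a n • w n x)
      = fun x => ∑ n ∈ S, a n • (pderiv i)^[k] (w n) x := by
  induction k with
  | zero => rfl
  | succ k ih =>
    simp only [Function.iterate_succ_apply']
    rw [ih]
    exact pderiv_sum S a (fun n => contDiff_iterate_pderiv (hw n) i k) i

theorem contDiff_multiDeriv {g : E3 → E3} (hg : ContDiff ℝ ∞ g) (β : Fin 3 → ℕ) :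
    ContDiff ℝ ∞ (multiDeriv β g) :=
  contDiff_iterate_pderiv (contDiff_iterate_pderiv (contDiff_iterate_pderiv hg _ _) _ _) _ _

theorem periodic_multiDeriv {L : ℝ} {g : E3 → E3} (hg : Periodic L g) (β : Fin 3 → ℕ) :
    Periodic L (multiDeriv β g) :=
  periodic_iterate_pderiv (periodic_iterate_pderiv (periodic_iterate_pderiv hg _ _) _ _) _ _

theorem multiDeriv_sum {ι : Type} (S : Finset ι) (a : ι → ℝ) {w : ι → E3 → E3}
    (hw : ∀ n, ContDiff ℝ ∞ (w n)) (β : Fin 3 → ℕ) :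
    multiDeriv β (fun x => ∑ n ∈ S, a n • w n x)
      = fun x => ∑ n ∈ S, a n • multiDeriv β (w n) x := by
  have h2 := fun n => contDiff_iterate_pderiv (hw n) 2 (β 2)
  have h1 := fun n => contDiff_iterate_pderiv (h2 n) 1 (β 1)
  rw [multiDeriv, iterate_pderiv_sum S a hw, iterate_pderiv_sum S a h2, iterate_pderiv_sum S a h1]
  rfl

/-- The derivatives of the localized blocks are continuous in time. -/
theorem continuousOn_multiDeriv_block {χ : E3 → ℝ} (hχ : IsCutoff χ) {L T : ℝ} (hL : 0 < L)
    {u : ℝ → E3 → E3} (hu : WeaklyContinuous L T u) (q : ℤ) {θ : E3 → ℝ} (hθ : ContDiff ℝ ∞ θ)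
    (β : Fin 3 → ℕ) (x : E3) :
    ContinuousOn (fun t => multiDeriv β (fun y => θ y • block χ L q (u t) y) x) (Icc 0 T) := by
  -- Separation of variables: finitely many scalar coefficients depending on time, times fixed
  -- smooth fields. The Boolean selects cosine or sine.
  set S : Finset (((Fin 3 → ℤ) × Fin 3) × Bool) :=
    (blockFreqs q ×ˢ Finset.univ) ×ˢ Finset.univ with hS
  set a : ℝ → ((Fin 3 → ℤ) × Fin 3) × Bool → ℝ := fun t n =>
    if n.2 then blockRe χ L q (u t) n.1.1 n.1.2 else -blockIm χ L q (u t) n.1.1 n.1.2 with ha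
  set w : ((Fin 3 → ℤ) × Fin 3) × Bool → E3 → E3 := fun n y =>
    (θ y * if n.2 then Real.cos (phase L n.1.1 y) else Real.sin (phase L n.1.1 y)) • e n.1.2 with hw
  have hexp : ∀ t, (fun y => θ y • block χ L q (u t) y) = fun y => ∑ n ∈ S, a t n • w n y := by
    intro t
    funext y
    have he : ∀ v : E3, v = ∑ i, v i • e i := fun v => by
      ext j
      rw [Fin.sum_univ_three]
      fin_cases j <;> simp [e]
    rw [block_eq_trigField hχ hL, trigField, hS, Finset.sum_product, Finset.sum_product,
      Finset.smul_sum]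
    refine Finset.sum_congr rfl fun n _ => ?_
    simp only [Fintype.sum_bool, ha, hw, if_true, Bool.false_eq_true, if_false]
    conv_lhs => rw [he (blockRe χ L q (u t) n), he (blockIm χ L q (u t) n)]
    rw [Finset.smul_sum, Finset.smul_sum, ← Finset.sum_sub_distrib, Finset.smul_sum]
    refine Finset.sum_congr rfl fun i _ => ?_
    module
  have hwc : ∀ n, ContDiff ℝ ∞ (w n) := by
    rintro ⟨⟨n, i⟩, b⟩
    have h := (phase L n).contDiff (n := ∞)
    refine ContDiff.smul (hθ.mul ?_) contDiff_const
    cases b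
    · exact Real.contDiff_sin.comp h
    · exact Real.contDiff_cos.comp h
  have hac : ∀ n, ContinuousOn (fun t => a t n) (Icc 0 T) := by
    rintro ⟨⟨n, i⟩, b⟩
    cases b
    · exact (((EuclideanSpace.proj i : E3 →L[ℝ] ℝ).continuous.comp_continuousOn
        (continuousOn_blockIm hu q n))).neg
    · exact (EuclideanSpace.proj i : E3 →L[ℝ] ℝ).continuous.comp_continuousOn
        (continuousOn_blockRe hu q n)
  simp only [hexp, multiDeriv_sum S _ hwc]
  exact continuousOn_finsetSum _ fun n _ => (hac n).smul continuousOn_const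

/-! ### Atomic coefficients -/

section AtomCoeff

variable {χ η : E3 → ℝ} {L T : ℝ} {u : ℝ → E3 → E3}

theorem finite_multiIndices (M : ℕ) : Finite {β : Fin 3 → ℕ // ∑ i, β i ≤ M} := by
  refine (Set.Finite.subset (Set.finite_Iic (fun _ : Fin 3 => M)) fun β hβ i => ?_ :
    {β : Fin 3 → ℕ | ∑ i, β i ≤ M}.Finite)
  exact (Finset.single_le_sum (fun j _ => Nat.zero_le (β j)) (Finset.mem_univ i)).trans hβ

/-- A real `⨆` of an unbounded family is 0 by convention, so boundedness is needed before the
supremum dominates its members. -/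
theorem bddAbove_norm_multiDeriv (hχ : IsCutoff χ) (hη : IsMollifier η) (hL : 0 < L)
    (q : ℕ) (k : Fin 3 → ℤ) (t : ℝ) (β : Fin 3 → ℕ) : BddAbove (Set.range fun x : E3 =>
      ‖multiDeriv β (fun y => smoothCube η L q k y • block χ L q (u t) y) x‖) := by
  have hs := (contDiff_smoothCube hη hL q k).smul (contDiff_block hχ hL q (u t))
  have hp : Periodic L (fun y => smoothCube η L q k y • block χ L q (u t) y) := fun x i => by
    simp only [periodic_smoothCube η hL q k x i, periodic_block hχ hL q (u t) x i]
  obtain ⟨C, hC⟩ := (periodic_multiDeriv hp β).exists_norm_le hL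
    (contDiff_multiDeriv hs β).continuous
  exact ⟨C, by rintro _ ⟨x, rfl⟩; exact hC x⟩

/-- A strict lower bound is witnessed by one derivative at one point; this presents s_{qk} as a
supremum of functions continuous in time. -/
theorem lt_atomCoeff_iff (hχ : IsCutoff χ) (hη : IsMollifier η) (hL : 0 < L) (M q : ℕ)
    (k : Fin 3 → ℤ) (t c : ℝ) : c < atomCoeff χ η M L u q k t ↔
      ∃ (β : Fin 3 → ℕ) (x : E3), ∑ i, β i ≤ M ∧ c < (waveNumber L q ^ (∑ i, β i))⁻¹ *
        ‖multiDeriv β (fun y => smoothCube η L q k y • block χ L q (u t) y) x‖ := by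
  have hfin := finite_multiIndices M
  have hpos : ∀ n : ℕ, 0 < (waveNumber L q ^ n)⁻¹ := fun n =>
    inv_pos.mpr (pow_pos (waveNumber_pos hL q) n)
  constructor
  · intro h
    have : Nonempty {β : Fin 3 → ℕ // ∑ i, β i ≤ M} := ⟨⟨0, by simp⟩⟩
    obtain ⟨⟨β, hβ⟩, h1⟩ := exists_lt_of_lt_ciSup h
    rw [← div_lt_iff₀' (hpos _)] at h1
    obtain ⟨x, hx⟩ := exists_lt_of_lt_ciSup h1
    rw [div_lt_iff₀' (hpos _)] at hx
    exact ⟨β, x, hβ, hx⟩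
  · rintro ⟨β, x, hβ, h⟩
    refine lt_of_lt_of_le h (le_trans ?_ (le_ciSup (Set.finite_range _).bddAbove
      (⟨β, hβ⟩ : {β : Fin 3 → ℕ // ∑ i, β i ≤ M})))
    exact mul_le_mul_of_nonneg_left
      (le_ciSup (bddAbove_norm_multiDeriv hχ hη hL q k t β) x) (hpos _).le

theorem norm_smoothCube_smul_block_le (hχ : IsCutoff χ) (hη : IsMollifier η) (hL : 0 < L)
    (M q : ℕ) (k : Fin 3 → ℤ) (t : ℝ) (x : E3) :
    ‖smoothCube η L q k x • block χ L q (u t) x‖ ≤ atomCoeff χ η M L u q k t := by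
  by_contra! h
  have := (lt_atomCoeff_iff (u := u) hχ hη hL M q k t (atomCoeff χ η M L u q k t)).mpr
    ⟨0, x, by simp, by simpa [multiDeriv] using h⟩
  exact lt_irrefl _ this

theorem lowerSemicontinuousOn_atomCoeff (hχ : IsCutoff χ) (hη : IsMollifier η) (hL : 0 < L)
    (hu : WeaklyContinuous L T u) (M q : ℕ) (k : Fin 3 → ℤ) :
    LowerSemicontinuousOn (atomCoeff χ η M L u q k) (Icc 0 T) := by
  intro t ht c hc
  simp only [lt_atomCoeff_iff hχ hη hL] at hc ⊢
  obtain ⟨β, x, hβ, h⟩ := hc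
  have hcont := ((continuousOn_multiDeriv_block hχ hL hu q (contDiff_smoothCube hη hL q k)
    β x).norm.const_mul ((waveNumber L q ^ (∑ i, β i))⁻¹)) t ht
  filter_upwards [hcont.eventually (lt_mem_nhds h)] with s hs
  exact ⟨β, x, hβ, hs⟩

/-! ### Active regions -/

/-- Lower semicontinuity makes the active times of each cube relatively open; the region is a union
of products of these with open dilated cubes. -/
theorem exists_isOpen_activeRegion (hχ : IsCutoff χ) (hη : IsMollifier η) (hL : 0 < L)
    (hu : WeaklyContinuous L T u) (M : ℕ) (σ : ℕ → ℝ) (q : ℕ) : ∃ U : Set (ℝ × E3), IsOpen U ∧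
      activeRegion (openDilatedCube L) χ η M σ L T u q = U ∩ slab T := by
  have h := fun k => lowerSemicontinuousOn_iff_preimage_Ioi.mp
    (lowerSemicontinuousOn_atomCoeff hχ hη hL hu M q k)
      (σ q * (moment χ L T u 3 q / moment χ L T u 2 q))
  choose V hVo hV using h
  refine ⟨⋃ k ∈ cubeIndices q, V k ×ˢ openDilatedCube L q k,
    isOpen_biUnion fun k _ => (hVo k).prod isOpen_interior, ?_⟩
  ext ⟨t, x⟩
  simp only [activeRegion, mem_ofPred_eq, mem_inter_iff, mem_iUnion, mem_prod, exists_prop, slab,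
    mem_univ, and_true, mem_cubeIndices]
  rw [and_comm]
  refine and_congr_left fun ht => exists_congr fun k => and_congr_right fun _ =>
    and_congr_left fun _ => ?_
  have := Set.ext_iff.mp (hV k) t
  simp only [mem_inter_iff, mem_preimage, mem_Ioi, ht, true_and] at this
  exact this

theorem periodic_activeRegion (hL : 0 < L) (M : ℕ) (σ : ℕ → ℝ) (q : ℕ) (t : ℝ) :
    Periodic L (fun x => (t, x) ∈ activeRegion (openDilatedCube L) χ η M σ L T u q) := by
  intro x i
  refine propext (and_congr_right fun _ => exists_congr fun k => and_congr_right fun _ =>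
    and_congr_right fun _ => ?_)
  exact (periodic_openDilatedCube hL q k x i).to_iff

theorem avg_nonneg (hL : 0 < L) (hT : 0 < T) {g : ℝ × E3 → ℝ} (hg : ∀ z, 0 ≤ g z) :
    0 ≤ avg L T g :=
  mul_nonneg (by positivity) (integral_nonneg hg)

theorem moment_nonneg (hL : 0 < L) (hT : 0 < T) (r : ℕ) (q : ℤ) : 0 ≤ moment χ L T u r q :=
  avg_nonneg hL hT fun _ => by positivity

/-- Off the active region the block is controlled by the threshold. -/
theorem norm_block_le_of_notMem_activeRegion (hχ : IsCutoff χ) (hη : IsMollifier η) (hL : 0 < L)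
    (hT : 0 < T) (M : ℕ) {σ : ℕ → ℝ} (hσ : ∀ q, 0 < σ q) {q : ℕ} {z : ℝ × E3}
    (hz : z ∈ slab T) (hA : z ∉ activeRegion (openDilatedCube L) χ η M σ L T u q) :
    ‖block χ L q (u z.1) z.2‖ ≤ 27 * (σ q * (moment χ L T u 3 q / moment χ L T u 2 q)) := by
  set c := σ q * (moment χ L T u 3 q / moment χ L T u 2 q) with hc
  have hc0 : 0 ≤ c := mul_nonneg (hσ q).le
    (div_nonneg (moment_nonneg hL hT 3 q) (moment_nonneg hL hT 2 q))
  have hk : ∀ k ∈ (cubeIndices q).filter (fun k => smoothCube η L q k z.2 ≠ 0),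
      ‖smoothCube η L q k z.2 • block χ L q (u z.1) z.2‖ ≤ c := by
    intro k hk
    rw [Finset.mem_filter] at hk
    obtain ⟨y, hy, hxy⟩ := exists_near_of_smoothCube_ne_zero hη hk.2
    -- Since χ'_{qk} does not vanish at `z.2`, that point lies in the interior of Q*_{qk}; exceeding
    -- the threshold would make `z` active.
    refine (norm_smoothCube_smul_block_le hχ hη hL M q k z.1 z.2).trans (not_lt.mp fun hlt => hA ?_)
    exact ⟨hz.1, k, mem_cubeIndices.mp hk.1, hlt, mem_openDilatedCube_of_near hL hy hxy⟩
  calc ‖block χ L q (u z.1) z.2‖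
      = ‖∑ k ∈ (cubeIndices q).filter (fun k => smoothCube η L q k z.2 ≠ 0),
          smoothCube η L q k z.2 • block χ L q (u z.1) z.2‖ := by
        rw [← Finset.sum_smul, Finset.sum_filter_ne_zero, sum_smoothCube hη hL, one_smul]
    _ ≤ ∑ k ∈ (cubeIndices q).filter (fun k => smoothCube η L q k z.2 ≠ 0), c :=
        norm_sum_le_of_le _ hk
    _ = ((cubeIndices q).filter fun k => smoothCube η L q k z.2 ≠ 0).card * c := by
        rw [Finset.sum_const, nsmul_eq_mul]
    _ ≤ 27 * c := by
        gcongr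
        exact_mod_cast card_smoothCube_ne_zero_le hη hL q z.2

theorem activeRegion_mono {D D' : ℕ → (Fin 3 → ℤ) → Set E3} {M : ℕ} {σ : ℕ → ℝ} {q : ℕ}
    (h : ∀ k, D q k ⊆ D' q k) :
    activeRegion D χ η M σ L T u q ⊆ activeRegion D' χ η M σ L T u q := by
  rintro z ⟨hz, k, hk, hlt, hm⟩
  exact ⟨hz, k, hk, hlt, h k hm⟩

theorem activeRegion_ae_eq (hL : 0 < L) (M : ℕ) (σ : ℕ → ℝ) (q : ℕ) :
    activeRegion (openDilatedCube L) χ η M σ L T u q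
      =ᵐ[volume] activeRegion (dilatedCube L) χ η M σ L T u q := by
  have hnull : ∀ᵐ z : ℝ × E3, z.2 ∉ dyadicFaces L q := by
    have h : ∀ᵐ x : E3, x ∉ dyadicFaces L q := measure_eq_zero_iff_ae_notMem.mp
      (volume_dyadicFaces L q)
    exact Measure.quasiMeasurePreserving_snd.ae h
  filter_upwards [hnull] with z hz
  refine propext ⟨fun h => activeRegion_mono (fun k => interior_subset) h, ?_⟩
  rintro ⟨ht, k, hk, hlt, hm⟩
  exact ⟨ht, k, hk, hlt, (dilatedCube_subset hL q k hm).resolve_right hz⟩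

end AtomCoeff

/-! ### Moments and `L³` norms -/

theorem eLpNorm_three_pow {α F : Type} [MeasurableSpace α] [NormedAddCommGroup F] (g : α → F)
    (μ : Measure α) : eLpNorm g 3 μ ^ 3 = ∫⁻ z, ‖g z‖ₑ ^ 3 ∂μ := by
  rw [eLpNorm_eq_lintegral_rpow_enorm_toReal (by norm_num) (by norm_num), ← ENNReal.rpow_natCast,
    ← ENNReal.rpow_mul]
  norm_num

theorem lintegral_mul_mul_le {α F G H : Type} [MeasurableSpace α] [NormedAddCommGroup F]
    [NormedAddCommGroup G] [NormedAddCommGroup H] {μ : Measure α} {f : α → F} {g : α → G}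
    {h : α → H} (hf : AEStronglyMeasurable f μ) (hg : AEStronglyMeasurable g μ)
    (hh : AEStronglyMeasurable h μ) :
    ∫⁻ z, ‖f z‖ₑ * ‖g z‖ₑ * ‖h z‖ₑ ∂μ ≤ eLpNorm f 3 μ * eLpNorm g 3 μ * eLpNorm h 3 μ := by
  have key := ENNReal.lintegral_prod_norm_pow_le (μ := μ) (Finset.univ : Finset (Fin 3))
    (f := ![fun z => ‖f z‖ₑ ^ (3 : ℝ), fun z => ‖g z‖ₑ ^ (3 : ℝ), fun z => ‖h z‖ₑ ^ (3 : ℝ)])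
    (p := fun _ => 1 / 3) (by
      intro i _
      fin_cases i
      · exact hf.enorm.pow_const _
      · exact hg.enorm.pow_const _
      · exact hh.enorm.pow_const _) (by simp) (by intro i _; positivity)
  have hroot : ∀ x : ENNReal, (x ^ (3 : ℝ)) ^ (1 / 3 : ℝ) = x := fun x => by
    rw [← ENNReal.rpow_mul]; norm_num
  simp only [Fin.prod_univ_three] at key
  change ∫⁻ z, (‖f z‖ₑ ^ (3 : ℝ)) ^ (1 / 3 : ℝ) * (‖g z‖ₑ ^ (3 : ℝ)) ^ (1 / 3 : ℝ) *
    (‖h z‖ₑ ^ (3 : ℝ)) ^ (1 / 3 : ℝ) ∂μ ≤ (∫⁻ z, ‖f z‖ₑ ^ (3 : ℝ) ∂μ) ^ (1 / 3 : ℝ) *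
      (∫⁻ z, ‖g z‖ₑ ^ (3 : ℝ) ∂μ) ^ (1 / 3 : ℝ) *
        (∫⁻ z, ‖h z‖ₑ ^ (3 : ℝ) ∂μ) ^ (1 / 3 : ℝ) at key
  simp only [hroot] at key
  rw [eLpNorm_eq_lintegral_rpow_enorm_toReal (by norm_num) (by norm_num),
    eLpNorm_eq_lintegral_rpow_enorm_toReal (by norm_num) (by norm_num),
    eLpNorm_eq_lintegral_rpow_enorm_toReal (by norm_num) (by norm_num)]
  simpa using key

section Flux

variable {χ η : E3 → ℝ} {L T : ℝ} {u : ℝ → E3 → E3}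

/-- Continuity on the slab gives integrability, without which the Bochner integral in `moment` could
be the default value 0. -/
theorem lintegral_block_pow (hχ : IsCutoff χ) (hL : 0 < L) (hT : 0 < T)
    (hu : WeaklyContinuous L T u) (r : ℕ) (q : ℤ) :
    ∫⁻ z in cylinder L T, ‖block χ L q (u z.1) z.2‖ₑ ^ r
      = ENNReal.ofReal (T * L ^ 3 * moment χ L T u r q) := by
  have hint : IntegrableOn (fun z : ℝ × E3 => ‖block χ L q (u z.1) z.2‖ ^ r) (cylinder L T) :=
    integrableOn_cylinder_of_slab L ((continuousOn_block hχ hL hu q).norm.pow r)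
  have h1 : T * L ^ 3 * moment χ L T u r q
      = ∫ z in cylinder L T, ‖block χ L q (u z.1) z.2‖ ^ r := by
    rw [moment, avg, mul_inv_cancel_left₀ (by positivity)]
  rw [h1, ofReal_integral_eq_lintegral_ofReal hint (ae_of_all _ fun z => by positivity)]
  refine lintegral_congr fun z => ?_
  rw [ENNReal.ofReal_pow (norm_nonneg _), ofReal_norm]

/-- The scaling ratio of the `L³` norms of the blocks, `2^{-1/3}`. -/
def blockRatio : ℝ := (1 / 2 : ℝ) ^ (1 / 3 : ℝ)

theorem blockRatio_pos : 0 < blockRatio := by unfold blockRatio; positivity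

theorem blockRatio_pow_three : blockRatio ^ 3 = 1 / 2 := by
  rw [blockRatio, ← Real.rpow_natCast, ← Real.rpow_mul (by norm_num)]
  norm_num

theorem blockRatio_lt_one : blockRatio < 1 := by
  unfold blockRatio
  exact Real.rpow_lt_one (by norm_num) (by norm_num) (by norm_num)

theorem blockRatio_zpow_pow_three (q : ℤ) : (blockRatio ^ q) ^ 3 = (2 ^ q)⁻¹ := by
  rw [← zpow_natCast, ← zpow_mul, mul_comm, zpow_mul, zpow_natCast, blockRatio_pow_three,
    one_div, inv_zpow]

/-- The critical Onsager regularity makes the scaled moments bounded. -/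
theorem exists_moment_le (hε : limsup (fun q : ℕ => ENNReal.ofReal
    (waveNumber L q * moment χ L T u 3 q)) atTop < ⊤) :
    ∃ C : ℝ, ∀ q : ℕ, waveNumber L q * moment χ L T u 3 q ≤ C := by
  obtain ⟨b, hb1, hb2⟩ := exists_between hε
  have hev := eventually_lt_of_limsup_lt hb1
  have hbd : IsBoundedUnder (· ≤ ·) atTop
      (fun q : ℕ => waveNumber L q * moment χ L T u 3 q) := by
    refine ⟨b.toReal, ?_⟩
    rw [eventually_map]
    filter_upwards [hev] with q hq
    exact (ENNReal.ofReal_le_iff_le_toReal hb2.ne).mp hq.le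
  -- An eventual bound on a sequence bounds all its terms.
  obtain ⟨C, hC⟩ := hbd.bddAbove_range
  exact ⟨C, fun q => hC ⟨q, rfl⟩⟩

theorem exists_moment_scaling (hL : 0 < L) (hT : 0 < T)
    (hε : limsup (fun q : ℕ => ENNReal.ofReal
      (waveNumber L q * moment χ L T u 3 q)) atTop < ⊤) :
    ∃ C : ℝ, 0 ≤ C ∧ ∀ q : ℕ,
      T * L ^ 3 * moment χ L T u 3 q ≤ (C * blockRatio ^ (q : ℤ)) ^ 3 := by
  obtain ⟨C, hC⟩ := exists_moment_le hε
  -- The lower bound 1 gives `D ≤ D ^ 3`, which avoids a cube root.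
  set D : ℝ := max 1 (T * L ^ 4 * C) with hD
  have hD1 : 1 ≤ D := le_max_left _ _
  refine ⟨D, by linarith, fun q => ?_⟩
  rw [mul_pow, blockRatio_zpow_pow_three, zpow_natCast]
  have h2 : (0 : ℝ) < 2 ^ q := by positivity
  have h1 : T * L ^ 3 * moment χ L T u 3 q
      = T * L ^ 4 * (waveNumber L q * moment χ L T u 3 q) * (2 ^ q)⁻¹ := by
    rw [waveNumber]; field_simp
  rw [h1]
  refine mul_le_mul_of_nonneg_right ?_ (by positivity)
  calc _ ≤ T * L ^ 4 * C := by gcongr; exact hC q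
    _ ≤ D := le_max_right _ _
    _ ≤ D ^ 3 := le_self_pow₀ hD1 (by norm_num)

theorem exists_eLpNorm_block_le (hχ : IsCutoff χ) (hL : 0 < L) (hT : 0 < T)
    (hu : WeaklyContinuous L T u) {C : ℝ} (hC0 : 0 ≤ C) (hC : ∀ q : ℕ,
      T * L ^ 3 * moment χ L T u 3 q ≤ (C * blockRatio ^ (q : ℤ)) ^ 3) :
    ∃ A : ℝ, 0 ≤ A ∧ ∀ q : ℤ, -1 ≤ q →
      eLpNorm (fun z : ℝ × E3 => block χ L q (u z.1) z.2) 3 (volume.restrict (cylinder L T))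
        ≤ ENNReal.ofReal (A * blockRatio ^ q) := by
  have hr := blockRatio_pos
  set a := T * L ^ 3 * moment χ L T u 3 (-1) with ha
  set A := max C (max 1 (a / 2)) with hA
  refine ⟨A, hC0.trans (le_max_left _ _), fun q hq => ?_⟩
  rw [← ENNReal.pow_le_pow_left_iff (n := 3) (by norm_num), eLpNorm_three_pow,
    lintegral_block_pow hχ hL hT hu, ← ENNReal.ofReal_pow (mul_nonneg (hC0.trans
      (le_max_left _ _)) (by positivity))]
  refine ENNReal.ofReal_le_ofReal ?_
  rcases eq_or_lt_of_le hq with h | h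
  · rw [← h, ← ha, mul_pow, blockRatio_zpow_pow_three]
    have h1 : 1 ≤ A := (le_max_left _ _).trans (le_max_right _ _)
    have h2 : a / 2 ≤ A := (le_max_right _ _).trans (le_max_right _ _)
    have h3 : A ≤ A ^ 3 := le_self_pow₀ h1 (by norm_num)
    norm_num
    linarith
  · lift q to ℕ using by omega
    refine (hC q).trans ?_
    gcongr
    exact le_max_left _ _

/-- Off the active regions the blocks are of lower order in `L³`. -/
theorem eLpNorm_block_off_le (hχ : IsCutoff χ) (hη : IsMollifier η) (hL : 0 < L) (hT : 0 < T)
    (hu : WeaklyContinuous L T u) (M : ℕ) {σ : ℕ → ℝ} (hσ : ∀ q, 0 < σ q)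
    {C : ℝ} (hC0 : 0 ≤ C) (hC : ∀ q : ℕ,
      T * L ^ 3 * moment χ L T u 3 q ≤ (C * blockRatio ^ (q : ℤ)) ^ 3) (q : ℕ)
    {S : Set (ℝ × E3)} (hS : MeasurableSet S) (hSc : S ⊆ cylinder L T)
    (hSa : Disjoint S (activeRegion (openDilatedCube L) χ η M σ L T u q)) :
    eLpNorm (fun z : ℝ × E3 => block χ L q (u z.1) z.2) 3 (volume.restrict S)
      ≤ ENNReal.ofReal (C * (27 * σ q) ^ (1 / 3 : ℝ) * blockRatio ^ (q : ℤ)) := by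
  have hr := blockRatio_pos
  have hσq := hσ q
  set m3 := moment χ L T u 3 q with hm3
  set m2 := moment χ L T u 2 q with hm2
  have h3 : 0 ≤ m3 := moment_nonneg hL hT 3 q
  have h2 : 0 ≤ m2 := moment_nonneg hL hT 2 q
  have hc : 0 ≤ 27 * (σ q * (m3 / m2)) := by positivity
  rw [← ENNReal.pow_le_pow_left_iff (n := 3) (by norm_num), eLpNorm_three_pow,
    ← ENNReal.ofReal_pow (by positivity)]
  calc ∫⁻ z in S, ‖block χ L q (u z.1) z.2‖ₑ ^ 3
      ≤ ∫⁻ z in S, ENNReal.ofReal (27 * (σ q * (m3 / m2))) * ‖block χ L q (u z.1) z.2‖ₑ ^ 2 := by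
        refine setLIntegral_mono' hS fun z hz => ?_
        rw [pow_succ' _ 2]
        gcongr
        rw [← ofReal_norm]
        exact ENNReal.ofReal_le_ofReal (norm_block_le_of_notMem_activeRegion hχ hη hL hT M hσ
          (cylinder_subset_slab L T (hSc hz)) (disjoint_left.mp hSa hz))
    _ ≤ ENNReal.ofReal (27 * (σ q * (m3 / m2))) *
          ∫⁻ z in cylinder L T, ‖block χ L q (u z.1) z.2‖ₑ ^ 2 := by
        rw [lintegral_const_mul' _ _ ENNReal.ofReal_ne_top]
        gcongr
    _ = ENNReal.ofReal (27 * (σ q * (m3 / m2)) * (T * L ^ 3 * m2)) := by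
        rw [lintegral_block_pow hχ hL hT hu, ← ENNReal.ofReal_mul hc]
    _ ≤ _ := by
        refine ENNReal.ofReal_le_ofReal ?_
        -- When `m2 = 0` the left side is 0 by the convention for division, so the inequality
        -- persists.
        have h4 : m3 / m2 * m2 ≤ m3 := by
          rcases eq_or_ne m2 0 with h | h
          · rw [h, mul_zero]; exact h3
          · rw [div_mul_cancel₀ _ h]
        have h5 : ((27 * σ q) ^ (1 / 3 : ℝ)) ^ 3 = 27 * σ q := by
          rw [← Real.rpow_natCast, ← Real.rpow_mul (by positivity)]
          norm_num
        calc 27 * (σ q * (m3 / m2)) * (T * L ^ 3 * m2)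
            = 27 * σ q * (T * L ^ 3) * (m3 / m2 * m2) := by ring
          _ ≤ 27 * σ q * (T * L ^ 3) * m3 := by gcongr
          _ = 27 * σ q * (T * L ^ 3 * m3) := by ring
          _ ≤ 27 * σ q * (C * blockRatio ^ (q : ℤ)) ^ 3 := by gcongr; exact hC q
          _ = _ := by rw [mul_pow, mul_pow, mul_pow, h5]; ring

/-! ### The flux -/

theorem interaction_eq (P : ℤ × ℤ × ℤ) (z : ℝ × E3) : interaction χ L u P z =
    ∑ i, block χ L P.1 (u z.1) z.2 i *
      inner ℝ (block χ L P.2.1 (u z.1) z.2) (pderiv i (block χ L P.2.2 (u z.1)) z.2) := by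
  set v := block χ L P.1 (u z.1) z.2
  have he : v = ∑ i, v i • e i := by
    ext j
    rw [Fin.sum_univ_three]
    fin_cases j <;> simp [e]
  rw [interaction]
  conv_lhs => rw [show block χ L P.1 (u z.1) z.2 = ∑ i, v i • e i from he]
  rw [map_sum, inner_sum]
  refine Finset.sum_congr rfl fun i _ => ?_
  rw [map_smul, inner_smul_right, pderiv]

theorem continuousOn_interaction (hχ : IsCutoff χ) (hL : 0 < L) (hu : WeaklyContinuous L T u)
    {P : ℤ × ℤ × ℤ} (hP : -1 ≤ P.2.2) : ContinuousOn (interaction χ L u P) (slab T) := by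
  rw [show interaction χ L u P = _ from funext (interaction_eq P)]
  refine continuousOn_finsetSum _ fun i _ => ?_
  exact ((EuclideanSpace.proj i : E3 →L[ℝ] ℝ).continuous.comp_continuousOn
    (continuousOn_block hχ hL hu P.1)).mul
    (ContinuousOn.inner (𝕜 := ℝ) (continuousOn_block hχ hL hu P.2.1)
      (continuousOn_pderiv_block hχ hL hu hP i))

theorem enorm_interaction_le (P : ℤ × ℤ × ℤ) (z : ℝ × E3) : ‖interaction χ L u P z‖ₑ ≤
    ∑ i, ‖block χ L P.1 (u z.1) z.2‖ₑ * ‖block χ L P.2.1 (u z.1) z.2‖ₑ *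
      ‖pderiv i (block χ L P.2.2 (u z.1)) z.2‖ₑ := by
  rw [interaction_eq]
  refine (enorm_sum_le _ _).trans (Finset.sum_le_sum fun i _ => ?_)
  rw [enorm_mul, mul_assoc]
  refine mul_le_mul' ?_ ?_
  · exact enorm_le_iff_norm_le.mpr (PiLp.norm_apply_le _ i)
  · rw [← ofReal_norm, ← ofReal_norm, ← ofReal_norm, ← ENNReal.ofReal_mul (norm_nonneg _)]
    exact ENNReal.ofReal_le_ofReal (norm_inner_le_norm _ _)

/-- Hölder's and Bernstein's inequalities for one interaction. -/
theorem lintegral_interaction_le (hχ : IsCutoff χ) (hL : 0 < L) (hu : WeaklyContinuous L T u)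
    {P : ℤ × ℤ × ℤ} (hP : -1 ≤ P.2.2) {S : Set (ℝ × E3)} (hSc : S ⊆ cylinder L T)
    {A a b : ℝ} (hA0 : 0 ≤ A) (ha0 : 0 ≤ a)
    (hA : eLpNorm (fun z : ℝ × E3 => block χ L P.2.2 (u z.1) z.2) 3
      (volume.restrict (cylinder L T)) ≤ ENNReal.ofReal A)
    (ha : eLpNorm (fun z : ℝ × E3 => block χ L P.1 (u z.1) z.2) 3 (volume.restrict S)
      ≤ ENNReal.ofReal a)
    (hb0 : 0 ≤ b)
    (hb : eLpNorm (fun z : ℝ × E3 => block χ L P.2.1 (u z.1) z.2) 3 (volume.restrict S)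
      ≤ ENNReal.ofReal b) :
    ∫⁻ z in S, ‖interaction χ L u P z‖ₑ ≤
      ENNReal.ofReal (24 * Real.pi / L * (a * b * (2 ^ P.2.2 * A))) := by
  have hm : ∀ {F : Type} [NormedAddCommGroup F] [SecondCountableTopology F] {g : ℝ × E3 → F},
      ContinuousOn g (slab T) → AEStronglyMeasurable g (volume.restrict S) := fun hg =>
    (aestronglyMeasurable_of_slab hg).mono_measure (Measure.restrict_mono_set volume hSc)
  have h1 := hm (continuousOn_block hχ hL hu P.1)
  have h2 := hm (continuousOn_block hχ hL hu P.2.1)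
  have h3 := fun i => hm (continuousOn_pderiv_block hχ hL hu hP i)
  have hi : ∀ i, ∫⁻ z in S, ‖block χ L P.1 (u z.1) z.2‖ₑ * ‖block χ L P.2.1 (u z.1) z.2‖ₑ *
      ‖pderiv i (block χ L P.2.2 (u z.1)) z.2‖ₑ ≤
        ENNReal.ofReal (8 * Real.pi / L * (a * b * (2 ^ P.2.2 * A))) := by
    intro i
    refine (lintegral_mul_mul_le h1 h2 (h3 i)).trans ?_
    calc _ ≤ ENNReal.ofReal a * ENNReal.ofReal b *
          (ENNReal.ofReal (8 * Real.pi / L * 2 ^ P.2.2) * ENNReal.ofReal A) := by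
          refine mul_le_mul' (mul_le_mul' ha hb) ?_
          -- The gradient factor is enlarged to the whole cylinder: Bernstein's inequality relies on
          -- translation invariance, which `S` need not have.
          refine (eLpNorm_mono_measure _ (Measure.restrict_mono_set volume hSc)).trans ?_
          exact (eLpNorm_pderiv_block_le hχ hL hu hP i).trans (mul_le_mul_right hA _)
      _ = _ := by
          rw [← ENNReal.ofReal_mul ha0, ← ENNReal.ofReal_mul (by positivity),
            ← ENNReal.ofReal_mul (by positivity)]
          congr 1
          ring
  calc ∫⁻ z in S, ‖interaction χ L u P z‖ₑ
      ≤ ∫⁻ z in S, ∑ i, ‖block χ L P.1 (u z.1) z.2‖ₑ * ‖block χ L P.2.1 (u z.1) z.2‖ₑ *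
          ‖pderiv i (block χ L P.2.2 (u z.1)) z.2‖ₑ :=
        lintegral_mono fun z => enorm_interaction_le P z
    _ = ∑ i, ∫⁻ z in S, ‖block χ L P.1 (u z.1) z.2‖ₑ * ‖block χ L P.2.1 (u z.1) z.2‖ₑ *
          ‖pderiv i (block χ L P.2.2 (u z.1)) z.2‖ₑ :=
        lintegral_finsetSum' _ fun i _ => (h1.enorm.mul h2.enorm).mul (h3 i).enorm
    _ ≤ ∑ _i : Fin 3, ENNReal.ofReal (8 * Real.pi / L * (a * b * (2 ^ P.2.2 * A))) :=
        Finset.sum_le_sum fun i _ => hi i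
    _ = _ := by
        rw [← ENNReal.ofReal_sum_of_nonneg fun _ _ => by positivity, Fin.sum_univ_three]
        congr 1
        ring

/-! ### Summation over the triples of block indices -/

/-- The position of a triple of block indices relative to the scale of the flux. -/
def fluxPosition (p : ℕ) (P : fluxIndex p) : ℕ × ℕ × Fin 3 :=
  ((P.1.1 - (p - 1)).toNat, (p - 1 - P.1.2.2).toNat, ⟨(P.1.2.1 - P.1.1 + 1).toNat, by
    have := P.2.2.2.2.2
    rw [abs_lt] at this
    omega⟩)

theorem fluxIndex_eq {p : ℕ} (P : fluxIndex p) :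
    P.1.1 = p - 1 + (fluxPosition p P).1 ∧
      P.1.2.1 = p - 2 + (fluxPosition p P).1 + ((fluxPosition p P).2.2 : ℕ) ∧
      P.1.2.2 = p - 1 - (fluxPosition p P).2.1 := by
  obtain ⟨⟨a, b, c⟩, h1, h2, h3, h4, h5⟩ := P
  simp only [abs_lt] at h1 h2 h3 h4 h5
  simp only [fluxPosition]
  omega

theorem fluxPosition_injective (p : ℕ) : Function.Injective (fluxPosition p) := by
  intro P Q h
  obtain ⟨a1, a2, a3⟩ := fluxIndex_eq P
  obtain ⟨b1, b2, b3⟩ := fluxIndex_eq Q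
  rw [h] at a1 a2 a3
  exact Subtype.ext (Prod.ext (a1.trans b1.symm) (Prod.ext (a2.trans b2.symm) (a3.trans b3.symm)))

/-- The decay of the interactions away from the scale of the flux. -/
def fluxWeight (x : ℕ × ℕ × Fin 3) : ENNReal :=
  ENNReal.ofReal (blockRatio ^ 2) ^ x.1 * (ENNReal.ofReal (blockRatio ^ 2) ^ x.2.1)

/-- Two geometric series of ratio `r² < 1`, and a factor 3 from the last coordinate, on which the
weight does not depend. -/
theorem tsum_fluxWeight_ne_top : ∑' x, fluxWeight x ≠ ⊤ := by
  have hlt : ENNReal.ofReal (blockRatio ^ 2) < 1 := by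
    rw [ENNReal.ofReal_lt_one]
    exact pow_lt_one₀ blockRatio_pos.le blockRatio_lt_one (by norm_num)
  have hfin : (1 - ENNReal.ofReal (blockRatio ^ 2))⁻¹ ≠ ⊤ :=
    ENNReal.inv_ne_top.mpr (tsub_pos_of_lt hlt).ne'
  rw [ENNReal.tsum_prod']
  simp only [fluxWeight, ENNReal.tsum_mul_left, ENNReal.tsum_prod', ENNReal.tsum_mul_right,
    tsum_fintype, Finset.sum_const, ENNReal.tsum_geometric, nsmul_eq_mul]
  exact ENNReal.mul_ne_top hfin (ENNReal.mul_ne_top (by simp) hfin)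

/-- The sum of the `L¹` norms of the interactions on a set. -/
theorem tsum_lintegral_interaction_le (hχ : IsCutoff χ) (hL : 0 < L)
    (hu : WeaklyContinuous L T u) {A B : ℝ} (hA0 : 0 ≤ A) (hB0 : 0 ≤ B)
    (hA : ∀ q : ℤ, -1 ≤ q →
      eLpNorm (fun z : ℝ × E3 => block χ L q (u z.1) z.2) 3 (volume.restrict (cylinder L T))
        ≤ ENNReal.ofReal (A * blockRatio ^ q))
    (p : ℕ) {S : Set (ℝ × E3)} (hSc : S ⊆ cylinder L T)
    (hB : ∀ q : ℤ, (p : ℤ) - 1 ≤ q →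
      eLpNorm (fun z : ℝ × E3 => block χ L q (u z.1) z.2) 3 (volume.restrict S)
        ≤ ENNReal.ofReal (B * blockRatio ^ q)) :
    ∑' P : fluxIndex p, ∫⁻ z in S, ‖interaction χ L u P z‖ₑ ≤
      ENNReal.ofReal (24 * Real.pi / L * (B ^ 2 * A / blockRatio)) * ∑' x, fluxWeight x := by
  have hr := blockRatio_pos
  have hr1 := blockRatio_lt_one
  have hterm : ∀ P : fluxIndex p, ∫⁻ z in S, ‖interaction χ L u P z‖ₑ ≤
      ENNReal.ofReal (24 * Real.pi / L * (B ^ 2 * A / blockRatio)) *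
        fluxWeight (fluxPosition p P) := by
    intro P
    refine (lintegral_interaction_le hχ hL hu P.2.2.2.1 hSc (by positivity)
      (mul_nonneg hB0 (by positivity)) (hA _ P.2.2.2.1) (hB _ P.2.1) (mul_nonneg hB0 (by positivity))
      (hB _ (by have := P.2.2.1; omega))).trans ?_
    rw [fluxWeight, ← ENNReal.ofReal_pow (by positivity), ← ENNReal.ofReal_pow (by positivity),
      ← ENNReal.ofReal_mul (by positivity), ← ENNReal.ofReal_mul (by positivity)]
    refine ENNReal.ofReal_le_ofReal ?_
    obtain ⟨h1, h2, h3⟩ := fluxIndex_eq P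
    set n := (fluxPosition p P).1
    set j := (fluxPosition p P).2.1
    set d := ((fluxPosition p P).2.2 : ℕ)
    have two : (2 : ℝ) = blockRatio ^ (-3 : ℤ) := by
      rw [zpow_neg, zpow_ofNat, blockRatio_pow_three]; norm_num
    -- As `2 = r^{-3}`, the total exponent is `p' + p'' - 2p''' = 2n + 2j + d - 1`: the scale `p`
    -- cancels, which is the criticality of the exponent 1/3.
    have hpow : blockRatio ^ P.1.1 * blockRatio ^ P.1.2.1 *
        ((2 : ℝ) ^ P.1.2.2 * blockRatio ^ P.1.2.2)
        = blockRatio ^ d * ((blockRatio ^ 2) ^ n * (blockRatio ^ 2) ^ j / blockRatio) := by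
      have : ((2 : ℝ) ^ P.1.2.2 * blockRatio ^ P.1.2.2) = blockRatio ^ (-2 * P.1.2.2) := by
        conv_lhs => rw [two]
        rw [← zpow_mul, ← zpow_add₀ hr.ne']
        congr 1
        ring
      rw [this, ← zpow_add₀ hr.ne', ← zpow_add₀ hr.ne', ← pow_mul, ← pow_mul, ← pow_add,
        ← zpow_natCast, ← zpow_natCast, div_eq_mul_inv, ← zpow_sub_one₀ hr.ne', ← zpow_add₀ hr.ne', h1, h2, h3]
      congr 1
      push_cast
      ring
    have hd : blockRatio ^ d ≤ 1 := pow_le_one₀ hr.le hr1.le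
    calc _ = 24 * Real.pi / L * (B ^ 2 * A) * (blockRatio ^ P.1.1 * blockRatio ^ P.1.2.1 *
          ((2 : ℝ) ^ P.1.2.2 * blockRatio ^ P.1.2.2)) := by ring
      _ = 24 * Real.pi / L * (B ^ 2 * A) *
          (blockRatio ^ d * ((blockRatio ^ 2) ^ n * (blockRatio ^ 2) ^ j / blockRatio)) := by
            rw [hpow]
      _ ≤ 24 * Real.pi / L * (B ^ 2 * A) *
          (1 * ((blockRatio ^ 2) ^ n * (blockRatio ^ 2) ^ j / blockRatio)) := by gcongr
      _ = _ := by ring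
  calc _ ≤ ∑' P : fluxIndex p, ENNReal.ofReal (24 * Real.pi / L * (B ^ 2 * A / blockRatio)) *
        fluxWeight (fluxPosition p P) := ENNReal.tsum_le_tsum hterm
    _ = ENNReal.ofReal (24 * Real.pi / L * (B ^ 2 * A / blockRatio)) *
        ∑' P : fluxIndex p, fluxWeight (fluxPosition p P) := ENNReal.tsum_mul_left
    _ ≤ _ := mul_le_mul_right
        (ENNReal.tsum_comp_le_tsum_of_injective (fluxPosition_injective p) _) _

theorem lintegral_fluxDensity_le (hχ : IsCutoff χ) (hL : 0 < L) (hu : WeaklyContinuous L T u)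
    (p : ℕ) {S : Set (ℝ × E3)} (hSc : S ⊆ cylinder L T) :
    ∫⁻ z in S, ‖fluxDensity χ L u p z‖ₑ ≤
      ∑' P : fluxIndex p, ∫⁻ z in S, ‖interaction χ L u P z‖ₑ := by
  rw [← lintegral_tsum fun P : fluxIndex p => ((aestronglyMeasurable_of_slab
    (continuousOn_interaction hχ hL hu P.2.2.2.1)).mono_measure
      (Measure.restrict_mono_set volume hSc)).enorm]
  exact lintegral_mono fun z => enorm_tsum_le_tsum_enorm

/-- The flux density is well defined and integrable once the interactions are summable. -/
theorem integrableOn_fluxDensity (hχ : IsCutoff χ) (hL : 0 < L) (hu : WeaklyContinuous L T u)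
    (p : ℕ) (h : ∑' P : fluxIndex p, ∫⁻ z in cylinder L T, ‖interaction χ L u P z‖ₑ ≠ ⊤) :
    (∀ᵐ z ∂(volume.restrict (cylinder L T)),
      Summable fun P : fluxIndex p => interaction χ L u P z) ∧
    IntegrableOn (fluxDensity χ L u p) (cylinder L T) := by
  have hm : ∀ P : fluxIndex p,
      AEStronglyMeasurable (interaction χ L u P) (volume.restrict (cylinder L T)) := fun P =>
    aestronglyMeasurable_of_slab (continuousOn_interaction hχ hL hu P.2.2.2.1)
  have hs : ∀ᵐ z ∂(volume.restrict (cylinder L T)),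
      Summable fun P : fluxIndex p => interaction χ L u P z := by
    filter_upwards [summable_norm_of_tsum_eLpNorm_ne_top le_rfl hm
      (by simpa only [eLpNorm_one_eq_lintegral_enorm] using h)] with z hz
    exact hz.of_norm
  refine ⟨hs, ?_, ?_⟩
  -- The sum is the almost everywhere limit of its finite partial sums along the directed family of
  -- finite sets of triples.
  · refine aestronglyMeasurable_of_tendsto_ae (atTop : Filter (Finset (fluxIndex p)))
      (f := fun F z => ∑ P ∈ F, interaction χ L u P z)
      (fun F => Finset.aestronglyMeasurable_fun_sum F fun P _ => hm P) ?_
    filter_upwards [hs] with z hz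
    exact hz.hasSum
  · exact (lintegral_fluxDensity_le hχ hL hu p Subset.rfl).trans_lt h.lt_top

theorem fluxOff_nonneg (hL : 0 < L) (hT : 0 < T) (G : Set (ℝ × E3)) (p : ℕ) :
    0 ≤ fluxOff χ L T u G p :=
  avg_nonneg hL hT fun z => indicator_nonneg (fun _ _ => abs_nonneg _) z

theorem fluxOff_eq (p : ℕ) (hint : IntegrableOn (fluxDensity χ L u p) (cylinder L T))
    {G : Set (ℝ × E3)} (hG : MeasurableSet G) : fluxOff χ L T u G p =
      (T * L ^ 3)⁻¹ * (∫⁻ z in cylinder L T ∩ Gᶜ, ‖fluxDensity χ L u p z‖ₑ).toReal := by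
  rw [fluxOff, avg, setIntegral_indicator hG.compl,
    ← integral_norm_eq_lintegral_enorm (hint.mono_set inter_subset_left).aestronglyMeasurable]
  rfl

/-- Transfers decay from the open active regions to the larger half-open ones. -/
theorem fluxOff_mono (hL : 0 < L) (hT : 0 < T) (p : ℕ)
    (hint : IntegrableOn (fluxDensity χ L u p) (cylinder L T))
    {G G' : Set (ℝ × E3)} (hG : MeasurableSet G) (h : G ⊆ G') :
    fluxOff χ L T u G' p ≤ fluxOff χ L T u G p := by
  refine mul_le_mul_of_nonneg_left ?_ (by positivity)
  refine integral_mono_of_nonneg (ae_of_all _ fun z => indicator_nonneg (fun _ _ => abs_nonneg _) z)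
    (hint.abs.indicator hG.compl) (ae_of_all _ fun z => ?_)
  exact indicator_le_indicator_of_subset (compl_subset_compl.mpr h) (fun _ => abs_nonneg _) z

end Flux

/-! ### Concentration of the flux on the active regions -/

section Concentration

variable {χ η : E3 → ℝ} {L T : ℝ} {u : ℝ → E3 → E3} {M : ℕ} {σ : ℕ → ℝ}

theorem measurableSet_iUnion_activeRegion (hχ : IsCutoff χ) (hη : IsMollifier η) (hL : 0 < L)
    (hu : WeaklyContinuous L T u) (q : ℕ) :
    MeasurableSet (⋃ r ≥ q, activeRegion (openDilatedCube L) χ η M σ L T u r) := by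
  refine MeasurableSet.iUnion fun r => MeasurableSet.iUnion fun _ => ?_
  obtain ⟨U, hU, h⟩ := exists_isOpen_activeRegion hχ hη hL hu M σ r
  rw [h]
  exact hU.measurableSet.inter (measurableSet_slab T)

/-- The flux off the union of the active regions of high index vanishes in the limit. -/
theorem tendsto_fluxOff (hχ : IsCutoff χ) (hη : IsMollifier η) (hL : 0 < L) (hT : 0 < T)
    (hu : WeaklyContinuous L T u) (hσ : IsThreshold σ)
    (hint : ∀ p, IntegrableOn (fluxDensity χ L u p) (cylinder L T))
    {A C : ℝ} (hA0 : 0 ≤ A) (hA : ∀ q : ℤ, -1 ≤ q →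
      eLpNorm (fun z : ℝ × E3 => block χ L q (u z.1) z.2) 3 (volume.restrict (cylinder L T))
        ≤ ENNReal.ofReal (A * blockRatio ^ q))
    (hC0 : 0 ≤ C) (hC : ∀ q : ℕ,
      T * L ^ 3 * moment χ L T u 3 q ≤ (C * blockRatio ^ (q : ℤ)) ^ 3) (q : ℕ) :
    Tendsto (fun p => fluxOff χ L T u
      (⋃ r ≥ q, activeRegion (openDilatedCube L) χ η M σ L T u r) p) atTop (𝓝 0) := by
  have hr := blockRatio_pos
  set G := ⋃ r ≥ q, activeRegion (openDilatedCube L) χ η M σ L T u r with hGdef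
  have hG : MeasurableSet G := measurableSet_iUnion_activeRegion hχ hη hL hu q
  set B : ℕ → ℝ := fun p => C * (27 * σ p) ^ (1 / 3 : ℝ) with hB
  have hB0 : ∀ p, 0 ≤ B p := fun p =>
    mul_nonneg hC0 (Real.rpow_nonneg (by linarith [hσ.pos p]) _)
  have hBlim : Tendsto B atTop (𝓝 0) := by
    have h1 := (hσ.tendsto_zero.const_mul 27).rpow_const (p := 1 / 3) (Or.inr (by norm_num))
    have h2 := h1.const_mul C
    rwa [mul_zero, Real.zero_rpow (by norm_num), mul_zero] at h2
  set K := (∑' x, fluxWeight x).toReal with hK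
  -- The flux at `p + 1` involves high-frequency blocks from index `p` on. For `p ≥ q` these all
  -- have natural indices and active regions contained in `G`.
  have hbound : ∀ p, q ≤ p → fluxOff χ L T u G (p + 1) ≤
      (T * L ^ 3)⁻¹ * (24 * Real.pi / L * (B p ^ 2 * A / blockRatio) * K) := by
    intro p hp
    have hoff : ∀ r : ℤ, ((p + 1 : ℕ) : ℤ) - 1 ≤ r →
        eLpNorm (fun z : ℝ × E3 => block χ L r (u z.1) z.2) 3
          (volume.restrict (cylinder L T ∩ Gᶜ)) ≤ ENNReal.ofReal (B p * blockRatio ^ r) := by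
      intro r hpr
      push_cast at hpr
      lift r to ℕ using by omega
      have hpr' : p ≤ r := by omega
      refine (eLpNorm_block_off_le hχ hη hL hT hu M hσ.pos hC0 hC r
        ((measurableSet_cylinder L T).inter hG.compl) inter_subset_left ?_).trans ?_
      · refine disjoint_left.mpr fun z hz hA => hz.2 ?_
        exact mem_iUnion₂.mpr ⟨r, hp.trans hpr', hA⟩
      -- Monotonicity of σ bounds `σ r` by `σ p`, so the single constant `B p` serves all blocks of
      -- index at least `p`.
      · have := (hσ.pos r).le
        refine ENNReal.ofReal_le_ofReal (mul_le_mul_of_nonneg_right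
          (mul_le_mul_of_nonneg_left ?_ hC0) (by positivity))
        exact Real.rpow_le_rpow (by positivity)
          (mul_le_mul_of_nonneg_left (hσ.antitone hpr') (by norm_num)) (by norm_num)
    have hsum := (lintegral_fluxDensity_le hχ hL hu (p + 1) inter_subset_left).trans
      (tsum_lintegral_interaction_le hχ hL hu hA0 (hB0 p) hA (p + 1) inter_subset_left hoff)
    rw [fluxOff_eq (p + 1) (hint _) hG]
    refine mul_le_mul_of_nonneg_left ?_ (by positivity)
    have hnn : 0 ≤ 24 * Real.pi / L * (B p ^ 2 * A / blockRatio) := by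
      have := hB0 p
      positivity
    refine (ENNReal.toReal_mono (ENNReal.mul_ne_top ENNReal.ofReal_ne_top
      tsum_fluxWeight_ne_top) hsum).trans_eq ?_
    rw [ENNReal.toReal_mul, ENNReal.toReal_ofReal hnn]
  rw [← tendsto_add_atTop_iff_nat 1]
  refine squeeze_zero' (Eventually.of_forall fun p => fluxOff_nonneg hL hT G (p + 1))
    (eventually_atTop.mpr ⟨q, hbound⟩) ?_
  have h := (((((hBlim.pow 2).mul_const A).div_const blockRatio).const_mul
    (24 * Real.pi / L)).mul_const K).const_mul ((T * L ^ 3)⁻¹)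
  simpa using h

/-- Read for sets as predicates: membership in the limsup means membership infinitely often, so the
exceptional null sets may be treated one index at a time. -/
theorem limsup_pred_iff {α : Type} (P : ℕ → α → Prop) (z : α) :
    limsup P atTop z ↔ ∃ᶠ n in atTop, P n z := by
  rw [limsup_eq_iInf_iSup_of_nat]
  simp [iInf_apply, iSup_apply, frequently_atTop]

theorem limsup_activeRegion_ae_eq (hL : 0 < L) :
    limsup (activeRegion (openDilatedCube L) χ η M σ L T u) atTop
      =ᵐ[volume] limsup (activeRegion (dilatedCube L) χ η M σ L T u) atTop := by
  have h := ae_all_iff.mpr fun q =>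
    eventuallyEq_set.mp (activeRegion_ae_eq (χ := χ) (η := η) (T := T) (u := u) hL M σ q)
  refine eventuallyEq_set.mpr ?_
  filter_upwards [h] with z hz
  have hmem : ∀ q, z ∈ activeRegion (openDilatedCube L) χ η M σ L T u q ↔
      z ∈ activeRegion (dilatedCube L) χ η M σ L T u q := hz
  refine (limsup_pred_iff _ z).trans (Iff.trans ?_ (limsup_pred_iff _ z).symm)
  exact Iff.of_eq (congrArg (fun P : ℕ → Prop => ∃ᶠ n in atTop, P n)
    (funext fun q => propext (hmem q)))

theorem fluxConcentratesOn_limsup (hχ : IsCutoff χ) (hη : IsMollifier η) (hL : 0 < L)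
    (hu : WeaklyContinuous L T u) (h : ∀ q : ℕ, Tendsto (fun p : ℕ => fluxOff χ L T u
      (⋃ r ≥ q, activeRegion (openDilatedCube L) χ η M σ L T u r) p) atTop (𝓝 0)) :
    FluxConcentratesOn χ L T u
      (limsup (activeRegion (openDilatedCube L) χ η M σ L T u) atTop) := by
  have hlim : limsup (activeRegion (openDilatedCube L) χ η M σ L T u) atTop
      = ⋂ q, ⋃ r ≥ q, activeRegion (openDilatedCube L) χ η M σ L T u r :=
    limsup_eq_iInf_iSup_of_nat
  refine ⟨?_, fun q => ⋃ r ≥ q, activeRegion (openDilatedCube L) χ η M σ L T u r,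
    ?_, ?_, ?_, hlim, h⟩
  · rw [hlim]
    exact MeasurableSet.iInter fun q => measurableSet_iUnion_activeRegion hχ hη hL hu q
  · exact fun q q' hq => biUnion_subset_biUnion_left fun r hr => le_trans hq hr
  · intro q
    choose U hU hUeq using exists_isOpen_activeRegion (χ := χ) (η := η) hχ hη hL hu M σ
    refine ⟨⋃ r ≥ q, U r, isOpen_biUnion fun r _ => hU r, ?_⟩
    simp only [hUeq, iUnion_inter]
  · intro q t x i
    simp only [mem_iUnion, exists_prop, eq_iff_iff]
    exact exists_congr fun r => and_congr_right fun _ =>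
      (periodic_activeRegion hL M σ r t x i).to_iff

end Concentration

end EulerFlux

end

theorem theoremt (L T : ℝ) (hL : 0 < L) (hT : 0 < T)
    (χ η : EulerFlux.E3 → ℝ) (hχ : EulerFlux.IsCutoff χ) (hη : EulerFlux.IsMollifier η)
    (M : ℕ) (hM : 1 ≤ M) (σ : ℕ → ℝ) (hσ : EulerFlux.IsThreshold σ)
    (f u₀ : EulerFlux.E3 → EulerFlux.E3) (u : ℝ → EulerFlux.E3 → EulerFlux.E3)
    (hf : EulerFlux.Periodic L f) (hf2 : MemLp f 2 (volume.restrict (EulerFlux.box L)))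
    (hu₀ : EulerFlux.Periodic L u₀) (hu₀2 : MemLp u₀ 2 (volume.restrict (EulerFlux.box L)))
    (hu : EulerFlux.IsWeakEulerSolution L T f u₀ u)
    (hε : limsup (fun q : ℕ => ENNReal.ofReal
      (EulerFlux.waveNumber L q * EulerFlux.moment χ L T u 3 q)) atTop < ⊤) :
    -- the flux densities are well defined and integrable
    (∀ p : ℕ,
      (∀ᵐ z ∂(volume.restrict (EulerFlux.cylinder L T)),
        Summable (fun P : EulerFlux.fluxIndex p => EulerFlux.interaction χ L u P z)) ∧
      IntegrableOn (EulerFlux.fluxDensity χ L u p) (EulerFlux.cylinder L T)) ∧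
    -- the energy flux concentrates on `limsup A_q`, for the relatively open active regions
    EulerFlux.FluxConcentratesOn χ L T u
      (limsup (EulerFlux.activeRegion (EulerFlux.openDilatedCube L) χ η M σ L T u) atTop) ∧
    -- explicitly, with `G_q` the union of the open active regions of index at least `q`
    (∀ q : ℕ, Tendsto (fun p : ℕ => EulerFlux.fluxOff χ L T u
      (⋃ r ≥ q, EulerFlux.activeRegion (EulerFlux.openDilatedCube L) χ η M σ L T u r) p)
      atTop (𝓝 0)) ∧
    -- and likewise for the active regions made of half-open cubes
    (∀ q : ℕ, Tendsto (fun p : ℕ => EulerFlux.fluxOff χ L T u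
      (⋃ r ≥ q, EulerFlux.activeRegion (EulerFlux.dilatedCube L) χ η M σ L T u r) p)
      atTop (𝓝 0)) ∧
    -- the two versions of `limsup A_q` differ by a set of measure zero
    limsup (EulerFlux.activeRegion (EulerFlux.openDilatedCube L) χ η M σ L T u) atTop
      =ᵐ[volume] limsup (EulerFlux.activeRegion (EulerFlux.dilatedCube L) χ η M σ L T u) atTop := by
  have hw := hu.weaklyContinuous
  obtain ⟨C, hC0, hC⟩ := EulerFlux.exists_moment_scaling hL hT hε
  obtain ⟨A, hA0, hA⟩ := EulerFlux.exists_eLpNorm_block_le hχ hL hT hw hC0 hC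
  -- Integrability is the summation estimate on the whole cylinder, with the global constant `A` for
  -- the high-frequency factors too.
  have hflux := fun p => EulerFlux.integrableOn_fluxDensity hχ hL hw p
    (ne_top_of_le_ne_top (ENNReal.mul_ne_top ENNReal.ofReal_ne_top EulerFlux.tsum_fluxWeight_ne_top)
      (EulerFlux.tsum_lintegral_interaction_le hχ hL hw hA0 hA0 hA p Subset.rfl
        fun q hq => hA q (by omega)))
  have hint := fun p => (hflux p).2
  have hopen := EulerFlux.tendsto_fluxOff hχ hη hL hT hw hσ hint hA0 hA hC0 hC (M := M)
  refine ⟨hflux, EulerFlux.fluxConcentratesOn_limsup hχ hη hL hw hopen, hopen, fun q => ?_,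
    EulerFlux.limsup_activeRegion_ae_eq hL⟩
  exact squeeze_zero (fun p => EulerFlux.fluxOff_nonneg hL hT _ p)
    (fun p => EulerFlux.fluxOff_mono hL hT p (hint p)
      (EulerFlux.measurableSet_iUnion_activeRegion hχ hη hL hw q)
      (iUnion₂_mono fun r _ => EulerFlux.activeRegion_mono fun k => interior_subset)) (hopen q)
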